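/- Let $[n]=\{1,\dots,n\}$ and let $\|p-q\|_{\mathrm{TV}}=\frac12\sum_x|p(x)-q(x)|$. A product distribution on $[n]\times[m]$ is a distribution of the form $p(i,j)=p_1(i)\,p_2(j)$ with $p_1,p_2$ distributions on $[n]$ and $[m]$; a distribution is $\varepsilon$-far from product if its total variation distance to every product distribution is greater than $\varepsilon$. For $\alpha\in[0,1]$ and $\varepsilon,\delta\in(0,1)$, an $(\alpha,\varepsilon,\delta)$-augmented independence tester for distributions on $[n]\times[m]$ with $k$ samples is a randomized algorithm that receives a full description of a distribution $\hat p$ on $[n]\times[m]$ (the prediction) and $k$ independent samples from an unknown distribution $p$ on $[n]\times[m]$, outputs one of "accept", "reject", "inaccurate information", and satisfies for all $p$ and $\hat p$: (i) if $\|p-\hat p\|_{\mathrm{TV}}\le\alpha$, it outputs "inaccurate information" with probability at most $\delta/2$; (ii) if $p$ is a product distribution, it outputs "reject" with probability at most $\delta/2$; (iii) if $p$ is $\varepsilon$-far from product, it outputs "accept" with probability at most $\delta/2$. Theorem. There is an absolute constant $c>0$ such that for all integers $n\ge m\ge 2$ with $\log n\le m$, all $\alpha\in[0,1]$ and all $\varepsilon\in(0,1/3)$,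 every $(\alpha,\varepsilon,0.1)$-augmented independence tester for distributions on $[n]\times[m]$ uses $$k\ \ge\ c\cdot\max\left\{\frac{\sqrt{nm}}{\varepsilon^{2}},\ \frac{n^{2/3}m^{1/3}\alpha^{1/3}}{\varepsilon^{4/3}}\right\}$$ samples. -/

import Mathlib

namespace AugIndep

/-- Probability distributions on a finite set `Ω`: nonnegative weights of total mass one. -/
abbrev Distr (Ω : Type*) [Fintype Ω] : Type _ := stdSimplex ℝ Ω

/-- Total variation distance between two distributions on a finite set. -/
noncomputable def tvDist {Ω : Type*} [Fintype Ω] (p q : Distr Ω) : ℝ :=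
  (1 / 2) * ∑ x, |p.1 x - q.1 x|

/-- A distribution on `[n] × [m]` that is the product of a distribution on `[n]` and one on `[m]`. -/
def IsProductDist {n m : ℕ} (p : Distr (Fin n × Fin m)) : Prop :=
  ∃ (p₁ : Distr (Fin n)) (p₂ : Distr (Fin m)), ∀ i j, p.1 (i, j) = p₁.1 i * p₂.1 j

/-- `p` is at total variation distance more than `ε` from every product distribution. -/
def IsFarFromProduct {n m : ℕ} (ε : ℝ) (p : Distr (Fin n × Fin m)) : Prop :=
  ∀ q : Distr (Fin n × Fin m), IsProductDist q → ε < tvDist p q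

/-- The three possible outputs of an augmented tester. -/
inductive Verdict
  | accept
  | reject
  | inaccurateInformation
  deriving DecidableEq

instance : Fintype Verdict where
  elems := {Verdict.accept, Verdict.reject, Verdict.inaccurateInformation}
  complete v := by cases v <;> simp

/-- A randomized algorithm that knows a prediction `p̂` completely, uses at most `k` samples, and
outputs a verdict: every prediction and every sequence of `k` samples determine the distribution of
the output over the internal randomness. (An algorithm that stops early, adaptively or at random,
is one that ignores some of the `k` samples.) -/
abbrev Tester (n m k : ℕ) : Type :=
  Distr (Fin n × Fin m) → (Fin k → Fin n × Fin m) → Distr Verdict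

/-- The probability that `T`, given the prediction `phat` and `k` independent samples from `p`,
outputs `v`. -/
noncomputable def outputProb {n m k : ℕ} (T : Tester n m k) (phat p : Distr (Fin n × Fin m))
    (v : Verdict) : ℝ :=
  ∑ x : Fin k → Fin n × Fin m, (∏ i, p.1 (x i)) * (T phat x).1 v

/-- `T` is an `(α, ε, δ)`-augmented independence tester: for every unknown distribution `p` and
every prediction `phat`, each of the three kinds of error has probability at most `δ / 2`. -/
structure IsAugmentedIndependenceTester {n m k : ℕ} (α ε δ : ℝ) (T : Tester n m k) : Prop where
  /-- If the prediction is `α`-close to `p`, the tester rarely declares it inaccurate. -/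
  inaccurate_le : ∀ phat p : Distr (Fin n × Fin m), tvDist p phat ≤ α →
    outputProb T phat p Verdict.inaccurateInformation ≤ δ / 2
  /-- If `p` is a product distribution, the tester rarely rejects. -/
  reject_le : ∀ phat p : Distr (Fin n × Fin m), IsProductDist p →
    outputProb T phat p Verdict.reject ≤ δ / 2
  /-- If `p` is `ε`-far from all product distributions, the tester rarely accepts. -/
  accept_le : ∀ phat p : Distr (Fin n × Fin m), IsFarFromProduct ε p →
    outputProb T phat p Verdict.accept ≤ δ / 2

end AugIndep

/-!
A tester that meets conditions (i) and (ii) must accept often when `p` is a product distribution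
within `α` of the prediction, and by (iii) it must accept rarely when `p` is far from product. So it
distinguishes random instances of the two kinds, and a bound on the `χ²`-divergence between the
corresponding mixtures of `k`-sample distributions bounds `k` from below. The prediction is always
the uniform distribution on a grid of blocks.

For the bound `√(nm) / ε²` the rows and the columns are cut into pairs, and in each of the resulting
blocks the two diagonals are perturbed in opposite directions, with independent random signs.

For the bound `n ^ (2/3) m ^ (1/3) α ^ (1/3) / ε ^ (4/3)` the rows are cut into groups of four.
Each group is independently made heavy with a small probability, and only the light groups are
perturbed. The heavy groups stay within the error `α` allowed to the prediction, but
a group that receives several samples is then almost surely heavy, so the collisions that would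
reveal the perturbation are masked: a group with `t` samples contributes to the divergence at most
`t (t - 1) L ^ t e ^ 4 / M` divided by the null likelihood `1 - η + η B ^ t`, where `η` is the
probability of being heavy, `B` the mass of a heavy group, `L` the block size, `M` the number
of column blocks and `e` the strength of the perturbation.
-/

namespace AugIndep

open Finset

section TotalVariation

variable {Ω X : Type*} [Fintype Ω] [Fintype X]

theorem map_apply [DecidableEq X] (f : Ω → X) (p : Distr Ω) (y : X) :
    (stdSimplex.map f p).1 y = ∑ x, if f x = y then p.1 x else 0 := by
  change FunOnFinite.linearMap ℝ ℝ f p.1 y = _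
  rw [FunOnFinite.linearMap_apply_apply, sum_filter]

theorem map_apply_of_injective {f : Ω → X} (hf : Function.Injective f) (p : Distr Ω) (x : Ω) :
    (stdSimplex.map f p).1 (f x) = p.1 x := by
  classical
  simp [map_apply, hf.eq_iff]

theorem tvDist_map_le (f : Ω → X) (p q : Distr Ω) :
    tvDist (stdSimplex.map f p) (stdSimplex.map f q) ≤ tvDist p q := by
  classical
  unfold tvDist
  gcongr 1 / 2 * ?_
  calc ∑ y, |(stdSimplex.map f p).1 y - (stdSimplex.map f q).1 y|
      ≤ ∑ y, ∑ x, if f x = y then |p.1 x - q.1 x| else 0 := by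
        refine sum_le_sum fun y _ => ?_
        rw [map_apply, map_apply, ← sum_sub_distrib]
        refine (abs_sum_le_sum_abs _ _).trans (sum_le_sum fun x _ => ?_)
        split_ifs <;> simp
    _ = ∑ x, |p.1 x - q.1 x| := by
        rw [sum_comm]
        simp

theorem sum_comp_le_sum {ι : Type*} {f : ι → X} (hf : Function.Injective f) (s : Finset ι)
    {F : X → ℝ} (hF : ∀ x, 0 ≤ F x) : ∑ i ∈ s, F (f i) ≤ ∑ x, F x := by
  classical
  rw [← sum_image (f := F) (fun x _ y _ h => hf h)]
  exact sum_le_univ_sum_of_nonneg hF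

theorem half_sum_abs_le_tvDist {ι : Type*} {f : ι → X} (hf : Function.Injective f) (s : Finset ι)
    (p q : Distr X) : 1 / 2 * ∑ i ∈ s, |p.1 (f i) - q.1 (f i)| ≤ tvDist p q := by
  unfold tvDist
  gcongr 1 / 2 * ?_
  exact sum_comp_le_sum hf s (F := fun x => |p.1 x - q.1 x|) fun _ => abs_nonneg _

theorem tvDist_eq_sum_sub_min (p q : Distr X) :
    tvDist p q = ∑ x, (p.1 x - min (p.1 x) (q.1 x)) := by
  have habs (x : X) : |p.1 x - q.1 x| = 2 * (p.1 x - min (p.1 x) (q.1 x)) - p.1 x + q.1 x := by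
    rcases le_total (p.1 x) (q.1 x) with h | h
    · rw [min_eq_left h, abs_of_nonpos (by linarith)]; ring
    · rw [min_eq_right h, abs_of_nonneg (by linarith)]; ring
  have hp : ∑ x, p.1 x = 1 := p.2.2
  have hq : ∑ x, q.1 x = 1 := q.2.2
  simp_rw [tvDist, habs]
  rw [sum_add_distrib, sum_sub_distrib, ← mul_sum, hp, hq]
  ring

theorem sum_sub_min_le_tvDist {ι : Type*} {f : ι → X} (hf : Function.Injective f) (s : Finset ι)
    (p q : Distr X) : ∑ i ∈ s, (p.1 (f i) - min (p.1 (f i)) (q.1 (f i))) ≤ tvDist p q := by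
  rw [tvDist_eq_sum_sub_min]
  exact sum_comp_le_sum hf s (F := fun x => p.1 x - min (p.1 x) (q.1 x))
    fun _ => sub_nonneg.2 (min_le_left _ _)

end TotalVariation

section Normalize

variable {Ω : Type*} [Fintype Ω]

/-- The distribution proportional to a nonnegative weight of positive total mass. -/
noncomputable def normalize (w : Ω → ℝ) (hw : ∀ x, 0 ≤ w x) (hs : 0 < ∑ x, w x) : Distr Ω :=
  ⟨fun x => w x / ∑ y, w y, fun x => div_nonneg (hw x) hs.le, by
    rw [← sum_div, div_self hs.ne']⟩

theorem pow_mul_prod_normalize {k : ℕ} (w : Ω → ℝ) (hw : ∀ x, 0 ≤ w x) (hs : 0 < ∑ x, w x)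
    (z : Fin k → Ω) : (∑ x, w x) ^ k * ∏ s, (normalize w hw hs).1 (z s) = ∏ s, w (z s) := by
  simp only [normalize, prod_div_distrib, prod_const, card_univ, Fintype.card_fin]
  exact mul_div_cancel₀ _ (pow_pos hs k).ne'

end Normalize

section Tester

variable {n m k : ℕ}

theorem outputProb_map {Ω : Type*} [Fintype Ω] (T : Tester n m k)
    (phat : Distr (Fin n × Fin m)) (f : Ω → Fin n × Fin m) (p : Distr Ω) (v : Verdict) :
    outputProb T phat (stdSimplex.map f p) v =
      ∑ z : Fin k → Ω, (∏ i, p.1 (z i)) * (T phat (f ∘ z)).1 v := by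
  classical
  unfold outputProb
  simp_rw [map_apply, Fintype.prod_sum, sum_mul]
  rw [sum_comm]
  refine sum_congr rfl fun z _ => ?_
  rw [sum_eq_single (f ∘ z)]
  · simp
  · intro x _ hx
    obtain ⟨i, hi⟩ : ∃ i, f (z i) ≠ x i := by
      by_contra! h
      exact hx (funext fun i => (h i).symm)
    rw [prod_eq_zero (mem_univ i) (by simp [hi]), zero_mul]
  · simp

theorem outputProb_nonneg (T : Tester n m k) (phat p : Distr (Fin n × Fin m)) (v : Verdict) :
    0 ≤ outputProb T phat p v :=
  sum_nonneg fun x _ => mul_nonneg (prod_nonneg fun _ _ => p.2.1 _) ((T phat x).2.1 v)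

theorem sum_outputProb (T : Tester n m k) (phat p : Distr (Fin n × Fin m)) :
    ∑ v, outputProb T phat p v = 1 := by
  have hT (x : Fin k → Fin n × Fin m) : ∑ v, (T phat x).1 v = 1 := (T phat x).2.2
  have hp : ∑ x, p.1 x = 1 := p.2.2
  unfold outputProb
  rw [sum_comm]
  simp_rw [← mul_sum, hT, mul_one]
  rw [← Fintype.sum_pow, hp, one_pow]

theorem outputProb_le_one (T : Tester n m k) (phat p : Distr (Fin n × Fin m)) (v : Verdict) :
    outputProb T phat p v ≤ 1 :=
  sum_outputProb T phat p ▸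
    single_le_sum (fun v _ => outputProb_nonneg T phat p v) (mem_univ v)

theorem one_sub_le_outputProb_accept {α ε δ : ℝ} {T : Tester n m k}
    (hT : IsAugmentedIndependenceTester α ε δ T) {phat p : Distr (Fin n × Fin m)}
    (hp : IsProductDist p) (hα : tvDist p phat ≤ α) :
    1 - δ ≤ outputProb T phat p Verdict.accept := by
  have huniv : (univ : Finset Verdict) =
    {Verdict.accept, Verdict.reject, Verdict.inaccurateInformation} := rfl
  have hsum := sum_outputProb T phat p
  rw [huniv, sum_insert (by decide), sum_pair (by decide)] at hsum
  linarith [hT.inaccurate_le phat p hα, hT.reject_le phat p hp]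

end Tester

section Mixture

variable {S Ω X : Type*} [Fintype S] [Fintype Ω] [Fintype X] {n m k : ℕ}

/-- The law of `k` independent samples from `p σ` for a hidden state `σ` with weights `u`; it has
total mass `∑ σ, u σ`, which need not be `1`. -/
noncomputable def mixture (u : S → ℝ) (p : S → Distr Ω) (z : Fin k → Ω) : ℝ :=
  ∑ σ, u σ * ∏ s, (p σ).1 (z s)

theorem sum_mixture (u : S → ℝ) (p : S → Distr Ω) :
    ∑ z : Fin k → Ω, mixture u p z = ∑ σ, u σ := by
  have hp (σ : S) : ∑ x, (p σ).1 x = 1 := (p σ).2.2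
  unfold mixture
  rw [sum_comm]
  simp_rw [← mul_sum, ← Fintype.sum_pow, hp, one_pow, mul_one]

theorem sum_mixture_mul_tester (u : S → ℝ) (p : S → Distr Ω) (T : Tester n m k)
    (phat : Distr (Fin n × Fin m)) (f : Ω → Fin n × Fin m) (v : Verdict) :
    ∑ z : Fin k → Ω, mixture u p z * (T phat (f ∘ z)).1 v =
      ∑ σ, u σ * outputProb T phat (stdSimplex.map f (p σ)) v := by
  simp_rw [mixture, outputProb_map, sum_mul, mul_sum, mul_assoc]
  exact sum_comm

theorem sq_sum_mul_sub_sum_mul_le (f g φ : X → ℝ) (hf : ∀ x, 0 < f x) (hφ0 : ∀ x, 0 ≤ φ x)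
    (hφ1 : ∀ x, φ x ≤ 1) (hfg : ∑ x, g x = ∑ x, f x) :
    (∑ x, f x * φ x - ∑ x, g x * φ x) ^ 2 ≤
      (∑ x, g x ^ 2 / f x - ∑ x, f x) * ∑ x, f x := by
  have hsqrt (x : X) : 0 < √(f x) := Real.sqrt_pos.2 (hf x)
  have hdiff : ∑ x, f x * φ x - ∑ x, g x * φ x =
      ∑ x, (f x - g x) / √(f x) * (√(f x) * φ x) := by
    rw [← sum_sub_distrib]
    refine sum_congr rfl fun x _ => ?_
    have := hsqrt x
    field_simp
  have hχ : ∑ x, ((f x - g x) / √(f x)) ^ 2 = ∑ x, g x ^ 2 / f x - ∑ x, f x := by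
    have hx (x : X) : ((f x - g x) / √(f x)) ^ 2 = g x ^ 2 / f x - 2 * g x + f x := by
      have := hf x
      rw [div_pow, Real.sq_sqrt this.le]
      field_simp
      ring
    simp_rw [hx]
    rw [sum_add_distrib, sum_sub_distrib, ← mul_sum, hfg]
    ring
  rw [hdiff, ← hχ]
  refine (sum_mul_sq_le_sq_mul_sq _ _ _).trans ?_
  refine mul_le_mul_of_nonneg_left (sum_le_sum fun x _ => ?_) (sum_nonneg fun _ _ => sq_nonneg _)
  rw [mul_pow, Real.sq_sqrt (hf x).le]
  exact mul_le_of_le_one_right (hf x).le (pow_le_one₀ (hφ0 x) (hφ1 x))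

theorem mul_sum_le_sum_mul_of_notMem {u a : S → ℝ} {bad : Finset S} {b β : ℝ}
    (hu : ∀ σ, 0 ≤ u σ) (ha : ∀ σ, 0 ≤ a σ) (hb : 0 ≤ b) (hgood : ∀ σ ∉ bad, b ≤ a σ)
    (hbad : ∑ σ ∈ bad, u σ ≤ β * ∑ σ, u σ) :
    b * (1 - β) * ∑ σ, u σ ≤ ∑ σ, u σ * a σ := by
  classical
  have hcompl : ∑ σ ∈ badᶜ, u σ * b ≤ ∑ σ, u σ * a σ :=
    (sum_le_sum fun σ hσ => mul_le_mul_of_nonneg_left (hgood σ (mem_compl.1 hσ)) (hu σ)).trans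
      (sum_le_univ_sum_of_nonneg fun σ => mul_nonneg (hu σ) (ha σ))
  rw [← sum_mul] at hcompl
  nlinarith [sum_add_sum_compl bad u]

theorem sum_mul_le_mul_sum_of_notMem {u a : S → ℝ} {bad : Finset S} {b β : ℝ}
    (hu : ∀ σ, 0 ≤ u σ) (ha : ∀ σ, a σ ≤ 1) (hb : 0 ≤ b) (hgood : ∀ σ ∉ bad, a σ ≤ b)
    (hbad : ∑ σ ∈ bad, u σ ≤ β * ∑ σ, u σ) :
    ∑ σ, u σ * a σ ≤ (b + β) * ∑ σ, u σ := by
  classical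
  have hin : ∑ σ ∈ bad, u σ * a σ ≤ ∑ σ ∈ bad, u σ :=
    sum_le_sum fun σ _ => mul_le_of_le_one_right (hu σ) (ha σ)
  have hout : ∑ σ ∈ badᶜ, u σ * a σ ≤ ∑ σ ∈ badᶜ, u σ * b :=
    sum_le_sum fun σ hσ => mul_le_mul_of_nonneg_left (hgood σ (mem_compl.1 hσ)) (hu σ)
  rw [← sum_mul] at hout
  have hle : ∑ σ ∈ badᶜ, u σ ≤ ∑ σ, u σ := sum_le_univ_sum_of_nonneg hu
  nlinarith [sum_add_sum_compl bad fun σ => u σ * a σ]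

-- The acceptance probabilities differ by at least `0.9 * 0.9 - (0.05 + 0.1) = 0.66`, and
-- `0.66 ^ 2 > 0.4`.
theorem le_of_chiSq_le [Nonempty Ω] {α ε x : ℝ} {T : Tester n m k}
    (hT : IsAugmentedIndependenceTester α ε 0.1 T) {phat : Distr (Fin n × Fin m)}
    (f : Ω → Fin n × Fin m) {u : S → ℝ} {p₀ p₁ : S → Distr Ω} {bad : Finset S}
    (hu : ∀ σ, 0 ≤ u σ) (hbad : ∑ σ ∈ bad, u σ ≤ 0.1 * ∑ σ, u σ)
    (hprod : ∀ σ ∉ bad, IsProductDist (stdSimplex.map f (p₀ σ)))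
    (hclose : ∀ σ ∉ bad, tvDist (stdSimplex.map f (p₀ σ)) phat ≤ α)
    (hfar : ∀ σ ∉ bad, IsFarFromProduct ε (stdSimplex.map f (p₁ σ)))
    (hpos : ∀ z : Fin k → Ω, 0 < mixture u p₀ z)
    (hχ : ∑ z : Fin k → Ω, mixture u p₁ z ^ 2 / mixture u p₀ z ≤ x * ∑ σ, u σ) :
    1.4 ≤ x := by
  have hZ : 0 < ∑ σ, u σ := by
    rw [← sum_mixture (k := k) u p₀]
    exact sum_pos (fun z _ => hpos z) univ_nonempty
  set Z := ∑ σ, u σ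
  have hCS := sq_sum_mul_sub_sum_mul_le (mixture u p₀) (mixture u p₁)
    (fun z => (T phat (f ∘ z)).1 Verdict.accept) hpos (fun z => (T phat (f ∘ z)).2.1 _)
    (fun z => stdSimplex.le_one (T phat (f ∘ z)) Verdict.accept)
    ((sum_mixture u p₁).trans (sum_mixture u p₀).symm)
  rw [sum_mixture_mul_tester, sum_mixture_mul_tester, sum_mixture] at hCS
  have h₀ := mul_sum_le_sum_mul_of_notMem hu (fun σ => outputProb_nonneg T phat _ _)
    (by norm_num : (0 : ℝ) ≤ 1 - 0.1)
    (fun σ hσ => one_sub_le_outputProb_accept hT (hprod σ hσ) (hclose σ hσ)) hbad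
  have h₁ := sum_mul_le_mul_sum_of_notMem hu (fun σ => outputProb_le_one T phat _ _)
    (by norm_num : (0 : ℝ) ≤ 0.1 / 2) (fun σ hσ => hT.accept_le phat _ (hfar σ hσ)) hbad
  have hsq : (0.66 * Z) ^ 2 ≤ (x * Z - Z) * Z :=
    (pow_le_pow_left₀ (by positivity) (by linarith) 2).trans
      (hCS.trans (mul_le_mul_of_nonneg_right (by linarith) hZ.le))
  have hZ2 : 0.66 ^ 2 * (Z * Z) ≤ (x - 1) * (Z * Z) := by linarith
  have hx := le_of_mul_le_mul_right hZ2 (by positivity)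
  norm_num at hx ⊢
  linarith

end Mixture

section Bump

variable {A : Type*} [AddCommGroup A] [Fintype A] [DecidableEq A]

/-- The indicator of the shifted diagonal `j = i + r`, centred and scaled so that its values are
`|A| - 1` and `-1`. Perturbing a uniform `A × A` block along it makes the block far from product. -/
noncomputable def bump (r i j : A) : ℝ := (if j = i + r then (Fintype.card A : ℝ) else 0) - 1

theorem bump_add (r i : A) : bump r i (i + r) = Fintype.card A - 1 := by simp [bump]

theorem bump_of_ne {r i j : A} (h : j ≠ i + r) : bump r i j = -1 := by simp [bump, h]

theorem sum_bump (r i : A) : ∑ j, bump r i j = 0 := by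
  simp [bump, sum_sub_distrib]

theorem sum_bump_mul (r i : A) (f : A → ℝ) :
    ∑ j, bump r i j * f j = Fintype.card A * f (i + r) - ∑ j, f j := by
  simp [bump, sub_mul, sum_sub_distrib]

theorem sum_bump_mul_bump (r r' i : A) :
    ∑ j, bump r i j * bump r' i j = Fintype.card A * bump 0 r r' := by
  rw [sum_bump_mul, sum_bump, sub_zero]
  simp [bump, eq_comm]

theorem neg_one_le_bump (r i j : A) : -1 ≤ bump r i j := by
  unfold bump; split_ifs <;> simp

theorem bump_le (r i j : A) : bump r i j ≤ Fintype.card A - 1 := by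
  unfold bump; split_ifs <;> simp

theorem one_add_mul_bump_nonneg {e : ℝ} (he : 0 ≤ e) (he1 : e ≤ 1) (r i j : A) :
    0 ≤ 1 + e * bump r i j := by
  nlinarith [neg_one_le_bump r i j]

theorem neg_card_le_sum_bump {κ : Type*} [Fintype κ] (r r' : κ → A) :
    -(Fintype.card κ : ℝ) ≤ ∑ J, bump 0 (r J) (r' J) := by
  simpa using card_nsmul_le_sum univ (fun J => bump 0 (r J) (r' J)) (-1)
    fun J _ => neg_one_le_bump _ _ _

theorem sub_le_abs_add_abs {a b b' : ℝ} (ha : 0 ≤ a) (hb : b ≤ b') (x y : ℝ) :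
    x - y ≤ |x - a * b| + |y - a * b'| := by
  have hab := mul_le_mul_of_nonneg_left hb ha
  linarith [le_abs_self (x - a * b), neg_abs_le (y - a * b')]

theorem le_sum_abs_row {c e a : ℝ} {r i j : A} {b : A → ℝ} (hj : j ≠ i + r) (ha : 0 ≤ a)
    (hb : b (i + r) ≤ b j) :
    c * e * Fintype.card A ≤ ∑ j, |c * (1 + e * bump r i j) - a * b j| := by
  calc c * e * Fintype.card A
      = c * (1 + e * bump r i (i + r)) - c * (1 + e * bump r i j) := by
        rw [bump_add, bump_of_ne hj]
        ring
    _ ≤ ∑ j' ∈ {i + r, j}, |c * (1 + e * bump r i j') - a * b j'| := by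
        rw [sum_pair hj.symm]
        exact sub_le_abs_add_abs ha hb _ _
    _ ≤ _ := sum_le_univ_sum_of_nonneg fun _ => abs_nonneg _

-- Of two rows, one has its diagonal column carrying the smaller factor `b`; there the product
-- cannot follow the bump.
theorem le_sum_abs_block [Nontrivial A] {c e : ℝ} (r : A) {a b : A → ℝ} (ha : ∀ i, 0 ≤ a i) :
    c * e * (Fintype.card A : ℝ) ^ 2 / 2 ≤ ∑ i, ∑ j, |c * (1 + e * bump r i j) - a i * b j| := by
  obtain ⟨d, hd⟩ := exists_ne (0 : A)
  set row : A → ℝ := fun i => ∑ j, |c * (1 + e * bump r i j) - a i * b j|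
  have hrow (i : A) : 0 ≤ row i := sum_nonneg fun _ _ => abs_nonneg _
  have htwo (i : A) : c * e * Fintype.card A ≤ row i + row (i + d) := by
    have hne : i + d + r ≠ i + r := by simpa [add_right_comm i d r] using hd
    rcases le_total (b (i + r)) (b (i + d + r)) with h | h
    · linarith [hrow (i + d), le_sum_abs_row (c := c) (e := e) hne (ha i) h]
    · linarith [hrow i, le_sum_abs_row (c := c) (e := e) hne.symm (ha (i + d)) h]
  have hshift : ∑ i, row (i + d) = ∑ i, row i := Equiv.sum_comp (Equiv.addRight d) row
  have hsum := card_nsmul_le_sum univ _ _ fun i _ => htwo i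
  rw [sum_add_distrib, hshift, card_univ, nsmul_eq_mul] at hsum
  linarith

theorem sum_sub_min_block {c : ℝ} (r : A) {a b : A → ℝ} (ha : ∀ i, 0 ≤ a i) (hb : ∀ i, 0 ≤ b i) :
    ∑ i, ∑ j, (c * (1 + 1 * bump r i j) - min (c * (1 + 1 * bump r i j)) (a i * b j)) =
      c * (Fintype.card A : ℝ) ^ 2 - ∑ i, min (c * Fintype.card A) (a i * b (i + r)) := by
  have hcell (i j : A) :
      c * (1 + 1 * bump r i j) - min (c * (1 + 1 * bump r i j)) (a i * b j) =
        if j = i + r then c * Fintype.card A - min (c * Fintype.card A) (a i * b j) else 0 := by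
    split_ifs with hj
    · simp [hj, bump_add]
    · simp [bump_of_ne hj, mul_nonneg (ha i) (hb j)]
  simp only [hcell, sum_ite_eq', mem_univ, if_true, sum_sub_distrib, sum_const, card_univ,
    nsmul_eq_mul]
  ring

end Bump

section DiagonalOverlap

/-- A block of product mass `P` has overlap at most `s * P + t * C` with a shifted diagonal of `A`
whose cells have mass `C` each. -/
def DiagonalOverlapBound (A : Type*) [AddCommGroup A] [Fintype A] (s t : ℝ) : Prop :=
  ∀ C : ℝ, 0 ≤ C → ∀ (r : A) (a b : A → ℝ), (∀ i, 0 ≤ a i) → (∀ i, 0 ≤ b i) →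
    ∑ i, min C (a i * b (i + r)) ≤ s * ((∑ i, a i) * ∑ i, b i) + t * C

-- `min C (x * y) ≤ √C * (√x * √y)`, then Cauchy–Schwarz and `√C * √P ≤ P / 4 + C`.
theorem diagonalOverlapBound (A : Type*) [AddCommGroup A] [Fintype A] :
    DiagonalOverlapBound A (1 / 4) 1 := by
  intro C hC r a b ha hb
  have hP : 0 ≤ (∑ i, a i) * ∑ i, b i :=
    mul_nonneg (sum_nonneg fun i _ => ha i) (sum_nonneg fun i _ => hb i)
  have hmin (i : A) : min C (a i * b (i + r)) ≤ √C * (√(a i) * √(b (i + r))) := by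
    rw [← Real.sqrt_mul (ha i), ← Real.sqrt_mul hC]
    apply Real.le_sqrt_of_sq_le
    rw [sq]
    exact mul_le_mul (min_le_left _ _) (min_le_right _ _)
      (le_min hC (mul_nonneg (ha i) (hb _))) hC
  have hshift : ∑ i, b (i + r) = ∑ i, b i := Equiv.sum_comp (Equiv.addRight r) b
  calc ∑ i, min C (a i * b (i + r))
      ≤ √C * ∑ i, √(a i) * √(b (i + r)) := by
        rw [mul_sum]
        exact sum_le_sum fun i _ => hmin i
    _ ≤ √C * √((∑ i, a i) * ∑ i, b i) := by
        gcongr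
        rw [Real.sqrt_mul (sum_nonneg fun i _ => ha i), ← hshift]
        exact Real.sum_sqrt_mul_sqrt_le univ ha fun i => hb (i + r)
    _ ≤ 1 / 4 * ((∑ i, a i) * ∑ i, b i) + 1 * C := by
        nlinarith [Real.sq_sqrt hC, Real.sq_sqrt hP, sq_nonneg (√C - √((∑ i, a i) * ∑ i, b i) / 2)]

theorem min_mul_add_min_mul_le {C x y z t : ℝ} (hC : 0 ≤ C) (hx : 0 ≤ x) (hy : 0 ≤ y)
    (hz : 0 ≤ z) (ht : 0 ≤ t) :
    min C (x * z) + min C (y * t) ≤ 1 / 3 * ((x + y) * (z + t)) + 2 / 3 * C := by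
  have hxz := mul_nonneg hx hz
  have hyt := mul_nonneg hy ht
  have : 0 ≤ x * t := mul_nonneg hx ht
  have : 0 ≤ y * z := mul_nonneg hy hz
  set X := min C (x * z)
  set Y := min C (y * t)
  have hX0 : 0 ≤ X := le_min hC hxz
  have hY0 : 0 ≤ Y := le_min hC hyt
  have hXC : X ≤ C := min_le_left _ _
  have hYC : Y ≤ C := min_le_left _ _
  have hX : X ≤ x * z := min_le_right _ _
  have hY : Y ≤ y * t := min_le_right _ _
  have hcross : 2 * min X Y ≤ x * t + y * z := by
    apply le_of_sq_le_sq _ (by positivity)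
    have hmul : min X Y * min X Y ≤ (x * z) * (y * t) :=
      mul_le_mul ((min_le_left _ _).trans hX) ((min_le_right _ _).trans hY) (le_min hX0 hY0) hxz
    nlinarith [sq_nonneg (x * t - y * z)]
  rcases le_total X Y with h | h
  · rw [min_eq_left h] at hcross; nlinarith
  · rw [min_eq_right h] at hcross; nlinarith

theorem diagonalOverlapBound_zmod_two : DiagonalOverlapBound (ZMod 2) (1 / 3) (2 / 3) := by
  intro C hC r a b ha hb
  have hshift : ∑ i, b (i + r) = ∑ i, b i := Equiv.sum_comp (Equiv.addRight r) b
  have huniv : (univ : Finset (ZMod 2)) = {0, 1} := by decide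
  rw [← hshift]
  simpa [huniv] using min_mul_add_min_mul_le hC (ha 0) (ha 1) (hb (0 + r)) (hb (1 + r))

end DiagonalOverlap

section Cells

variable {Γ A κ : Type*} {n m : ℕ}

/-- The embedding of `(Γ × A) × (κ × A)` in `[n] × [m]` which cuts the rows into groups indexed by
`Γ` and the columns into blocks indexed by `κ`. The cells of a row group `g` are indexed by
`A × κ × A`: row in the group, column block, column in the block. -/
def cellMap (ρ : Γ × A → Fin n) (γ : κ × A → Fin m) (ω : Γ × A × κ × A) : Fin n × Fin m :=
  (ρ (ω.1, ω.2.1), γ ω.2.2)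

theorem cellMap_injective {ρ : Γ × A → Fin n} {γ : κ × A → Fin m} (hρ : Function.Injective ρ)
    (hγ : Function.Injective γ) : Function.Injective (cellMap ρ γ) := by
  rintro ⟨g, i, J⟩ ⟨g', i', J'⟩ h
  simp only [cellMap, Prod.mk.injEq, hρ.eq_iff, hγ.eq_iff] at h
  simp [h.1.1, h.1.2, h.2]

variable [Fintype A] [Fintype κ]

theorem isProductDist_map_cellMap [Fintype Γ] (ρ : Γ × A → Fin n) (γ : κ × A → Fin m)
    {u : Distr (Γ × A)} {v : Distr (κ × A)} {p : Distr (Γ × A × κ × A)}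
    (hp : ∀ ω, p.1 ω = u.1 (ω.1, ω.2.1) * v.1 ω.2.2) :
    IsProductDist (stdSimplex.map (cellMap ρ γ) p) := by
  classical
  refine ⟨stdSimplex.map ρ u, stdSimplex.map γ v, fun i j => ?_⟩
  simp_rw [map_apply, hp]
  rw [sum_mul_sum, Fintype.sum_prod_type, Fintype.sum_prod_type]
  refine sum_congr rfl fun g _ => ?_
  rw [Fintype.sum_prod_type]
  refine sum_congr rfl fun a _ => sum_congr rfl fun b _ => ?_
  by_cases h1 : ρ (g, a) = i <;> by_cases h2 : γ b = j <;> simp [cellMap, h1, h2]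

theorem sum_blocks_le_one {ρ : Γ × A → Fin n} {γ : κ × A → Fin m} (hρ : Function.Injective ρ)
    (hγ : Function.Injective γ) (G : Finset Γ) (q₁ : Distr (Fin n)) (q₂ : Distr (Fin m)) :
    ∑ g ∈ G, ∑ J, (∑ i, q₁.1 (ρ (g, i))) * ∑ j, q₂.1 (γ (J, j)) ≤ 1 := by
  have hrows : ∑ g ∈ G, ∑ i, q₁.1 (ρ (g, i)) ≤ 1 := by
    rw [← sum_product' G univ fun g i => q₁.1 (ρ (g, i))]
    exact (sum_comp_le_sum hρ _ q₁.2.1).trans_eq q₁.2.2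
  have hcols : ∑ J, ∑ j, q₂.1 (γ (J, j)) ≤ 1 := by
    rw [← Fintype.sum_prod_type fun x => q₂.1 (γ x)]
    exact (sum_comp_le_sum hγ _ q₂.2.1).trans_eq q₂.2.2
  rw [← sum_mul_sum]
  exact mul_le_one₀ hrows (sum_nonneg fun _ _ => sum_nonneg fun _ _ => q₂.2.1 _) hcols

theorem sum_cells_eq_sum_blocks (G : Finset Γ) (F : Γ × A × κ × A → ℝ) :
    ∑ ω ∈ G ×ˢ univ, F ω = ∑ g ∈ G, ∑ J, ∑ i, ∑ j, F (g, i, J, j) := by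
  rw [sum_product]
  refine sum_congr rfl fun g _ => ?_
  simp_rw [Fintype.sum_prod_type]
  exact sum_comm

variable [AddCommGroup A] [DecidableEq A] {ρ : Γ × A → Fin n} {γ : κ × A → Fin m}
  {p q : Distr (Fin n × Fin m)} {G : Finset Γ} {c : ℝ} {r : Γ → κ → A}

theorem le_tvDist_of_perturbed [Nontrivial A] {e : ℝ} (hρ : Function.Injective ρ)
    (hγ : Function.Injective γ)
    (hp : ∀ g ∈ G, ∀ i J j, p.1 (cellMap ρ γ (g, i, J, j)) = c * (1 + e * bump (r g J) i j))
    (hq : IsProductDist q) :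
    e / 4 * (c * (Fintype.card A : ℝ) ^ 2 * (#G * Fintype.card κ)) ≤ tvDist p q := by
  obtain ⟨q₁, q₂, hq⟩ := hq
  calc e / 4 * (c * (Fintype.card A : ℝ) ^ 2 * (#G * Fintype.card κ))
      = 1 / 2 * ∑ _g ∈ G, ∑ _J : κ, c * e * (Fintype.card A : ℝ) ^ 2 / 2 := by
        simp only [sum_const, card_univ, nsmul_eq_mul]
        ring
    _ ≤ 1 / 2 * ∑ g ∈ G, ∑ J, ∑ i, ∑ j, |p.1 (cellMap ρ γ (g, i, J, j)) -
          q.1 (cellMap ρ γ (g, i, J, j))| := by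
        gcongr with g hg J
        simp_rw [hp g hg, cellMap, hq]
        exact le_sum_abs_block (r g J) (a := fun i => q₁.1 (ρ (g, i)))
          (b := fun j => q₂.1 (γ (J, j))) fun i => q₁.2.1 _
    _ ≤ tvDist p q := by
        rw [← sum_cells_eq_sum_blocks G fun ω => |p.1 (cellMap ρ γ ω) - q.1 (cellMap ρ γ ω)|]
        exact half_sum_abs_le_tvDist (cellMap_injective hρ hγ) _ p q

theorem le_tvDist_of_fully_perturbed {s t : ℝ} (hA : DiagonalOverlapBound A s t) (hs : 0 ≤ s)
    (hρ : Function.Injective ρ) (hγ : Function.Injective γ) (hc : 0 ≤ c)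
    (hp : ∀ g ∈ G, ∀ i J j, p.1 (cellMap ρ γ (g, i, J, j)) = c * (1 + 1 * bump (r g J) i j))
    (hq : IsProductDist q) :
    c * (Fintype.card A : ℝ) ^ 2 * (#G * Fintype.card κ)
      - (s + t * (c * Fintype.card A * (#G * Fintype.card κ))) ≤ tvDist p q := by
  obtain ⟨q₁, q₂, hq⟩ := hq
  set P := ∑ g ∈ G, ∑ J, (∑ i, q₁.1 (ρ (g, i))) * ∑ j, q₂.1 (γ (J, j))
  calc c * (Fintype.card A : ℝ) ^ 2 * (#G * Fintype.card κ)
        - (s + t * (c * Fintype.card A * (#G * Fintype.card κ)))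
      ≤ c * (Fintype.card A : ℝ) ^ 2 * (#G * Fintype.card κ)
        - (s * P + t * (c * Fintype.card A * (#G * Fintype.card κ))) := by
        gcongr
        exact mul_le_of_le_one_right hs (sum_blocks_le_one hρ hγ G q₁ q₂)
    _ = ∑ g ∈ G, ∑ J, (c * (Fintype.card A : ℝ) ^ 2 -
          (s * ((∑ i, q₁.1 (ρ (g, i))) * ∑ j, q₂.1 (γ (J, j))) + t * (c * Fintype.card A))) := by
        simp only [P, sum_sub_distrib, sum_add_distrib, mul_sum, sum_const, card_univ,
          nsmul_eq_mul]
        ring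
    _ ≤ ∑ g ∈ G, ∑ J, ∑ i, ∑ j, (p.1 (cellMap ρ γ (g, i, J, j)) -
          min (p.1 (cellMap ρ γ (g, i, J, j))) (q.1 (cellMap ρ γ (g, i, J, j)))) := by
        gcongr with g hg J
        simp_rw [hp g hg, cellMap, hq]
        rw [sum_sub_min_block (r g J) (a := fun i => q₁.1 (ρ (g, i)))
          (b := fun j => q₂.1 (γ (J, j))) (fun i => q₁.2.1 _) fun j => q₂.2.1 _]
        gcongr
        exact hA (c * Fintype.card A) (by positivity) (r g J) (fun i => q₁.1 (ρ (g, i)))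
          (fun j => q₂.1 (γ (J, j))) (fun i => q₁.2.1 _) fun j => q₂.2.1 _
    _ ≤ tvDist p q := by
        rw [← sum_cells_eq_sum_blocks G fun ω => p.1 (cellMap ρ γ ω) -
          min (p.1 (cellMap ρ γ ω)) (q.1 (cellMap ρ γ ω))]
        exact sum_sub_min_le_tvDist (cellMap_injective hρ hγ) _ p q

end Cells

section States

variable {Γ A κ : Type*} [Fintype Γ]

/-- The state of a row group: heavy (`true`), or light (`false`) and perturbed in each column block
along the diagonal with the given shift. -/
abbrev GroupState (κ A : Type*) : Type _ := Bool × (κ → A)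

/-- The total mass of the row groups, in units of the mass of a light group, when heavy groups
weigh `B`. -/
noncomputable def groupMass (B : ℝ) (σ : Γ → GroupState κ A) : ℝ :=
  ∑ g, if (σ g).1 then B else 1

/-- The number of heavy row groups. -/
def heavyCount (σ : Γ → GroupState κ A) : ℕ := #{g | (σ g).1 = true}

/-- The proportion of the total mass that lies in light row groups. -/
noncomputable def lightFraction (B : ℝ) (σ : Γ → GroupState κ A) : ℝ :=
  #{g | ¬(σ g).1 = true} / groupMass B σ

theorem groupMass_eq (B : ℝ) (σ : Γ → GroupState κ A) :
    groupMass B σ = Fintype.card Γ + (B - 1) * heavyCount σ := by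
  have hmass (b : Bool) : (if b then B else 1) = 1 + (B - 1) * if b = true then 1 else 0 := by
    split_ifs <;> ring
  simp only [groupMass, heavyCount, hmass, sum_add_distrib, ← mul_sum, sum_boole]
  simp

theorem card_le_groupMass {B : ℝ} (hB : 1 ≤ B) (σ : Γ → GroupState κ A) :
    (Fintype.card Γ : ℝ) ≤ groupMass B σ := by
  rw [groupMass_eq]
  have : 0 ≤ (B - 1) * heavyCount σ := mul_nonneg (by linarith) (Nat.cast_nonneg _)
  linarith

theorem groupMass_pos [Nonempty Γ] {B : ℝ} (hB : 0 < B) (σ : Γ → GroupState κ A) :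
    0 < groupMass B σ :=
  sum_pos (fun g _ => by split_ifs; exacts [hB, one_pos]) univ_nonempty

theorem one_sub_le_lightFraction [Nonempty Γ] {B : ℝ} (hB : 1 ≤ B) (σ : Γ → GroupState κ A) :
    1 - B * heavyCount σ / Fintype.card Γ ≤ lightFraction B σ := by
  have hW := groupMass_pos (zero_lt_one.trans_le hB) σ
  have hcount : (heavyCount σ : ℝ) + #{g | ¬(σ g).1 = true} = Fintype.card Γ := by
    rw [heavyCount, ← card_univ]
    exact_mod_cast card_filter_add_card_filter_not (s := univ) fun g => (σ g).1 = true
  have hlight : (#{g | ¬(σ g).1 = true} : ℝ) = groupMass B σ - B * heavyCount σ := by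
    rw [groupMass_eq]
    linarith
  rw [lightFraction, hlight, sub_div, div_self hW.ne']
  gcongr
  exact card_le_groupMass hB σ

variable [Fintype A] [Fintype κ]

theorem sum_const_cells (x : ℝ) :
    ∑ _c : A × κ × A, x = (Fintype.card A : ℝ) ^ 2 * Fintype.card κ * x := by
  simp only [sum_const, card_univ, Fintype.card_prod, nsmul_eq_mul, Nat.cast_mul]
  ring

/-- The total unnormalised mass of all cells. -/
noncomputable def totalMass (B : ℝ) (σ : Γ → GroupState κ A) : ℝ :=
  (Fintype.card A : ℝ) ^ 2 * Fintype.card κ * groupMass B σ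

theorem totalMass_pos [Nonempty Γ] [Nonempty A] [Nonempty κ] {B : ℝ} (hB : 0 < B)
    (σ : Γ → GroupState κ A) : 0 < totalMass B σ := by
  have hW := groupMass_pos hB σ
  unfold totalMass
  positivity

variable [AddCommGroup A] [DecidableEq A]

/-- The unnormalised mass of a cell of a row group in a given state; `e` is the strength of the
perturbation of light groups. -/
noncomputable def cellWeight {κ : Type*} (B e : ℝ) (τ : GroupState κ A) (c : A × κ × A) : ℝ :=
  if τ.1 then B else 1 + e * bump (τ.2 c.2.1) c.1 c.2.2

theorem cellWeight_nonneg {κ : Type*} {B e : ℝ} (hB : 0 ≤ B) (he : 0 ≤ e) (he1 : e ≤ 1)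
    (τ : GroupState κ A) (c : A × κ × A) : 0 ≤ cellWeight B e τ c := by
  unfold cellWeight
  split_ifs
  · exact hB
  · exact one_add_mul_bump_nonneg he he1 _ _ _

theorem cellWeight_zero {κ : Type*} (B : ℝ) (τ : GroupState κ A) (c : A × κ × A) :
    cellWeight B 0 τ c = if τ.1 then B else 1 := by
  simp [cellWeight]

theorem sum_bump_cells (r : κ → A) : ∑ c : A × κ × A, bump (r c.2.1) c.1 c.2.2 = 0 := by
  simp_rw [Fintype.sum_prod_type, sum_bump, sum_const_zero]

theorem sum_bump_mul_bump_cells (r r' : κ → A) :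
    ∑ c : A × κ × A, bump (r c.2.1) c.1 c.2.2 * bump (r' c.2.1) c.1 c.2.2 =
      (Fintype.card A : ℝ) ^ 2 * ∑ J, bump 0 (r J) (r' J) := by
  simp_rw [Fintype.sum_prod_type, sum_bump_mul_bump, ← mul_sum, sum_const, card_univ, nsmul_eq_mul]
  ring

theorem sum_perturbed (e : ℝ) (r : κ → A) :
    ∑ c : A × κ × A, (1 + e * bump (r c.2.1) c.1 c.2.2) =
      (Fintype.card A : ℝ) ^ 2 * Fintype.card κ := by
  rw [sum_add_distrib, ← mul_sum, sum_bump_cells, sum_const_cells]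
  ring

theorem sum_perturbed_mul_perturbed (e : ℝ) (r r' : κ → A) :
    ∑ c : A × κ × A, (1 + e * bump (r c.2.1) c.1 c.2.2) * (1 + e * bump (r' c.2.1) c.1 c.2.2) =
      (Fintype.card A : ℝ) ^ 2 * (Fintype.card κ + e ^ 2 * ∑ J, bump 0 (r J) (r' J)) := by
  have hexpand (c : A × κ × A) :
      (1 + e * bump (r c.2.1) c.1 c.2.2) * (1 + e * bump (r' c.2.1) c.1 c.2.2) =
        1 + e * bump (r c.2.1) c.1 c.2.2 + e * bump (r' c.2.1) c.1 c.2.2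
          + e ^ 2 * (bump (r c.2.1) c.1 c.2.2 * bump (r' c.2.1) c.1 c.2.2) := by ring
  simp_rw [hexpand, sum_add_distrib, ← mul_sum, sum_bump_cells, sum_bump_mul_bump_cells,
    sum_const_cells]
  ring

theorem sum_cellWeight (B e : ℝ) (τ : GroupState κ A) :
    ∑ c, cellWeight B e τ c =
      (Fintype.card A : ℝ) ^ 2 * Fintype.card κ * if τ.1 then B else 1 := by
  obtain ⟨b, r⟩ := τ
  cases b
  · simpa [cellWeight] using sum_perturbed e r
  · simpa [cellWeight] using sum_const_cells (A := A) (κ := κ) B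

theorem sum_cellWeight_heavy_mul_cellWeight (B e : ℝ) (r : κ → A) (τ : GroupState κ A) :
    ∑ c, cellWeight B e (true, r) c * cellWeight B e τ c =
      (Fintype.card A : ℝ) ^ 2 * Fintype.card κ * (B * if τ.1 then B else 1) := by
  have hheavy (c : A × κ × A) : cellWeight B e (true, r) c = B := if_pos rfl
  simp_rw [hheavy, ← mul_sum, sum_cellWeight]
  ring

theorem sum_cellWeight_light_mul_light [Nonempty κ] (B e : ℝ) (r r' : κ → A) :
    ∑ c, cellWeight B e (false, r) c * cellWeight B e (false, r') c =
      (Fintype.card A : ℝ) ^ 2 * Fintype.card κ *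
        (1 + e ^ 2 / Fintype.card κ * ∑ J, bump 0 (r J) (r' J)) := by
  simp only [cellWeight, Bool.false_eq_true, if_false, sum_perturbed_mul_perturbed]
  field_simp

theorem sum_sum_cellWeight (B e : ℝ) (σ : Γ → GroupState κ A) :
    ∑ ω : Γ × A × κ × A, cellWeight B e (σ ω.1) ω.2 = totalMass B σ := by
  simp_rw [Fintype.sum_prod_type (fun ω : Γ × A × κ × A => cellWeight B e (σ ω.1) ω.2),
    sum_cellWeight, ← mul_sum]
  rfl

variable [Nonempty Γ] [Nonempty κ]

/-- The distribution on cells determined by the states of the row groups. At `e = 0` it is a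
product distribution, whatever the states are. -/
noncomputable def stateDist {B e : ℝ} (hB : 0 < B) (he : 0 ≤ e) (he1 : e ≤ 1)
    (σ : Γ → GroupState κ A) : Distr (Γ × A × κ × A) :=
  normalize (fun ω => cellWeight B e (σ ω.1) ω.2) (fun _ => cellWeight_nonneg hB.le he he1 _ _) <|
    (totalMass_pos hB σ).trans_eq (sum_sum_cellWeight B e σ).symm

theorem stateDist_apply {B e : ℝ} (hB : 0 < B) (he : 0 ≤ e) (he1 : e ≤ 1)
    (σ : Γ → GroupState κ A) (ω : Γ × A × κ × A) :
    (stateDist hB he he1 σ).1 ω = cellWeight B e (σ ω.1) ω.2 / totalMass B σ := by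
  rw [← sum_sum_cellWeight B e σ]
  rfl

theorem totalMass_pow_mul_prod_stateDist {k : ℕ} {B e : ℝ} (hB : 0 < B) (he : 0 ≤ e) (he1 : e ≤ 1)
    (σ : Γ → GroupState κ A) (z : Fin k → Γ × A × κ × A) :
    totalMass B σ ^ k * ∏ s, (stateDist hB he he1 σ).1 (z s) =
      ∏ s, cellWeight B e (σ (z s).1) (z s).2 := by
  rw [← sum_sum_cellWeight B e σ]
  exact pow_mul_prod_normalize _ _ _ z

theorem isProductDist_stateDist_zero {n m : ℕ} {B : ℝ} (hB : 0 < B) (ρ : Γ × A → Fin n)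
    (γ : κ × A → Fin m) (σ : Γ → GroupState κ A) :
    IsProductDist (stdSimplex.map (cellMap ρ γ) (stateDist hB le_rfl zero_le_one σ)) := by
  have hW := groupMass_pos hB σ
  have : 0 < (Fintype.card A : ℝ) := by exact_mod_cast Fintype.card_pos
  have hsum : ∑ x : Γ × A, (if (σ x.1).1 then B else 1) = Fintype.card A * groupMass B σ := by
    rw [Fintype.sum_prod_type, groupMass, mul_sum]
    refine sum_congr rfl fun g _ => ?_
    rw [← nsmul_eq_mul, ← card_univ, ← sum_const]
  refine isProductDist_map_cellMap ρ γ (v := stdSimplex.barycenter)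
    (u := normalize (fun x : Γ × A => if (σ x.1).1 then B else 1)
      (fun x => by split_ifs; exacts [hB.le, zero_le_one]) (by rw [hsum]; positivity)) fun ω => ?_
  simp only [stateDist_apply, cellWeight_zero, normalize, hsum, stdSimplex.barycenter_apply,
    Fintype.card_prod, Nat.cast_mul, totalMass]
  field_simp

theorem tvDist_stateDist_zero_le {B : ℝ} (hB : 1 ≤ B) (σ : Γ → GroupState κ A) :
    tvDist (stateDist (zero_lt_one.trans_le hB) le_rfl zero_le_one σ) stdSimplex.barycenter ≤
      B * heavyCount σ / Fintype.card Γ := by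
  have hWG := card_le_groupMass hB σ
  have hW := groupMass_pos (zero_lt_one.trans_le hB) σ
  have : 0 < (Fintype.card A : ℝ) := by exact_mod_cast Fintype.card_pos
  set C : ℝ := (Fintype.card A : ℝ) ^ 2 * Fintype.card κ
  have hC : 0 < C := by positivity
  have hcell (ω : Γ × A × κ × A) :
      (stateDist (zero_lt_one.trans_le hB) le_rfl zero_le_one σ).1 ω -
        min ((stateDist (zero_lt_one.trans_le hB) le_rfl zero_le_one σ).1 ω)
          ((stdSimplex.barycenter : Distr (Γ × A × κ × A)).1 ω) ≤
      if (σ ω.1).1 = true then B / (C * Fintype.card Γ) else 0 := by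
    have huniform : (stdSimplex.barycenter : Distr (Γ × A × κ × A)).1 ω =
        1 / (C * Fintype.card Γ) := by
      simp only [stdSimplex.barycenter_apply, Fintype.card_prod, Nat.cast_mul, one_div, C]
      ring
    have hle (x : ℝ) (hx : 0 ≤ x) : x / (C * groupMass B σ) ≤ x / (C * Fintype.card Γ) := by
      gcongr
    rw [stateDist_apply, cellWeight_zero, huniform, totalMass]
    split_ifs
    · have hmin : 0 ≤ min (B / (C * groupMass B σ)) (1 / (C * Fintype.card Γ)) :=
        le_min (by positivity) (by positivity)
      linarith [hle B (by positivity)]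
    · rw [min_eq_left (hle 1 zero_le_one), sub_self]
  rw [tvDist_eq_sum_sub_min]
  refine (sum_le_sum fun ω _ => hcell ω).trans_eq ?_
  rw [Fintype.sum_prod_type]
  calc ∑ g, ∑ _c : A × κ × A, (if (σ g).1 = true then B / (C * Fintype.card Γ) else 0)
      = C * (heavyCount σ * (B / (C * Fintype.card Γ))) := by
        simp_rw [sum_const_cells, ← mul_sum, ← sum_filter, sum_const, nsmul_eq_mul]
        rfl
    _ = B * heavyCount σ / Fintype.card Γ := by field_simp

-- The strength `min 1 (5 * ε)` makes the first distance bound, which is linear in the strength,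
-- exceed `ε` when `ε ≤ 1 / 5`; beyond that the full perturbation is needed.
theorem isFarFromProduct_stateDist [Nontrivial A] {n m : ℕ} {s t B e ε : ℝ}
    (hA : DiagonalOverlapBound A s t) (hs : 0 ≤ s) (hB : 0 < B) (he : 0 ≤ e) (he1 : e ≤ 1)
    (heε : e = min 1 (5 * ε)) (hε : 0 < ε) (hε3 : ε < 1 / 3) {ρ : Γ × A → Fin n}
    {γ : κ × A → Fin m} (hρ : Function.Injective ρ) (hγ : Function.Injective γ)
    (σ : Γ → GroupState κ A) (hlight : 4 / 5 < lightFraction B σ)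
    (hoverlap : 1 / 3 ≤ lightFraction B σ - (s + t * (lightFraction B σ / Fintype.card A))) :
    IsFarFromProduct ε (stdSimplex.map (cellMap ρ γ) (stateDist hB he he1 σ)) := by
  intro q hq
  have hW := totalMass_pos hB σ
  have hcell : ∀ g ∈ ({g | ¬(σ g).1 = true} : Finset Γ), ∀ i J j,
      (stdSimplex.map (cellMap ρ γ) (stateDist hB he he1 σ)).1 (cellMap ρ γ (g, i, J, j)) =
        1 / totalMass B σ * (1 + e * bump ((σ g).2 J) i j) := by
    intro g hg i J j
    rw [map_apply_of_injective (cellMap_injective hρ hγ), stateDist_apply, cellWeight,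
      if_neg (mem_filter.1 hg).2]
    ring
  have hL : 0 < (Fintype.card A : ℝ) := by exact_mod_cast Fintype.card_pos
  have hfrac : 1 / totalMass B σ * (Fintype.card A : ℝ) ^ 2 *
      (#{g | ¬(σ g).1 = true} * Fintype.card κ) = lightFraction B σ := by
    have := groupMass_pos hB σ
    rw [lightFraction, totalMass]
    field_simp
  rcases lt_or_ge ε (1 / 5) with h5 | h5
  · have hdist := le_tvDist_of_perturbed hρ hγ (r := fun g => (σ g).2) hcell hq
    obtain rfl : e = 5 * ε := heε.trans (min_eq_right (by linarith))
    rw [hfrac] at hdist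
    exact (by nlinarith : ε < 5 * ε / 4 * lightFraction B σ).trans_le hdist
  · obtain rfl : e = 1 := heε.trans (min_eq_left (by linarith))
    have hdist := le_tvDist_of_fully_perturbed hA hs hρ hγ (r := fun g => (σ g).2)
      (by positivity) hcell hq
    have hfrac' : 1 / totalMass B σ * Fintype.card A *
        (#{g | ¬(σ g).1 = true} * Fintype.card κ) = lightFraction B σ / Fintype.card A := by
      rw [eq_div_iff hL.ne', ← hfrac]
      ring
    rw [hfrac, hfrac'] at hdist
    linarith

end States

section Reduction

variable {S Γ A κ : Type*} [Fintype S] [AddCommGroup A] [Fintype A] [DecidableEq A]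
  {n m k : ℕ} {α β ε B e : ℝ} {π : S → ℝ} {σ : S → Γ → GroupState κ A}

/-- The unnormalised law of `k` samples when the row groups are in states `σ x` with weight
`π x`. -/
noncomputable def stateMixture (B e : ℝ) (π : S → ℝ) (σ : S → Γ → GroupState κ A)
    (z : Fin k → Γ × A × κ × A) : ℝ :=
  ∑ x, π x * ∏ s, cellWeight B e (σ x (z s).1) (z s).2

theorem stateMixture_zero_pos (hB : 0 < B) (hπ : ∀ x, 0 ≤ π x) (hπ' : ∃ x, 0 < π x)
    (z : Fin k → Γ × A × κ × A) : 0 < stateMixture B 0 π σ z := by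
  have hprod (x : S) : 0 < ∏ s, cellWeight B 0 (σ x (z s).1) (z s).2 := by
    refine prod_pos fun s _ => ?_
    rw [cellWeight_zero]
    split_ifs
    exacts [hB, one_pos]
  obtain ⟨x, hx⟩ := hπ'
  exact sum_pos' (fun x _ => mul_nonneg (hπ x) (hprod x).le) ⟨x, mem_univ x, mul_pos hx (hprod x)⟩

variable [Fintype Γ] [Fintype κ] [Nonempty Γ] [Nonempty κ]

theorem mixture_stateDist (hB : 0 < B) (he : 0 ≤ e) (he1 : e ≤ 1) (z : Fin k → Γ × A × κ × A) :
    mixture (fun x => π x * totalMass B (σ x) ^ k) (fun x => stateDist hB he he1 (σ x)) z =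
      stateMixture B e π σ z := by
  simp_rw [mixture, stateMixture, mul_assoc, totalMass_pow_mul_prod_stateDist]

theorem le_of_stateMixture_chiSq_le [Nontrivial A] {s t x : ℝ} {T : Tester n m k}
    (hT : IsAugmentedIndependenceTester α ε 0.1 T) (hε : 0 < ε) (hε3 : ε < 1 / 3)
    (hA : DiagonalOverlapBound A s t) (hs : 0 ≤ s) (hB : 1 ≤ B) (heε : e = min 1 (5 * ε))
    {ρ : Γ × A → Fin n} {γ : κ × A → Fin m} (hρ : Function.Injective ρ)
    (hγ : Function.Injective γ) (hβα : β ≤ α) (hβ5 : β < 1 / 5)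
    (hβs : 1 / 3 + s ≤ (1 - β) * (1 - t / Fintype.card A)) (hπ : ∀ x, 0 ≤ π x)
    (hπ' : ∃ x, 0 < π x) {bad : Finset S}
    (hbad : ∑ x ∈ bad, π x * groupMass B (σ x) ^ k ≤ 0.1 * ∑ x, π x * groupMass B (σ x) ^ k)
    (hgood : ∀ x ∉ bad, B * heavyCount (σ x) / Fintype.card Γ ≤ β)
    (hχ : ∑ z : Fin k → Γ × A × κ × A, stateMixture B e π σ z ^ 2 / stateMixture B 0 π σ z ≤
      x * ∑ z : Fin k → Γ × A × κ × A, stateMixture B 0 π σ z) :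
    1.4 ≤ x := by
  have hB0 : 0 < B := by linarith
  have he : 0 ≤ e := heε ▸ le_min zero_le_one (by linarith)
  have he1 : e ≤ 1 := heε ▸ min_le_left _ _
  set C : ℝ := (Fintype.card A : ℝ) ^ 2 * Fintype.card κ
  have hmass (y : S) : π y * totalMass B (σ y) ^ k = C ^ k * (π y * groupMass B (σ y) ^ k) := by
    rw [totalMass, mul_pow]
    ring
  have hlight (y : S) (hy : y ∉ bad) : 1 - β ≤ lightFraction B (σ y) := by
    linarith [one_sub_le_lightFraction hB (σ y), hgood y hy]
  refine le_of_chiSq_le hT (cellMap ρ γ)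
    (phat := stdSimplex.map (cellMap ρ γ) stdSimplex.barycenter)
    (u := fun y => π y * totalMass B (σ y) ^ k)
    (p₀ := fun y => stateDist hB0 le_rfl zero_le_one (σ y))
    (p₁ := fun y => stateDist hB0 he he1 (σ y)) (bad := bad) ?_ ?_ ?_ ?_ ?_ ?_ ?_
  · exact fun y => mul_nonneg (hπ y) (pow_pos (totalMass_pos hB0 _) k).le
  · simp_rw [hmass, ← mul_sum]
    rw [mul_left_comm]
    gcongr
  · exact fun y _ => isProductDist_stateDist_zero hB0 ρ γ (σ y)
  · exact fun y hy => (tvDist_map_le _ _ _).trans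
      ((tvDist_stateDist_zero_le hB (σ y)).trans ((hgood y hy).trans hβα))
  · intro y hy
    have hℓ := hlight y hy
    have hst : 0 ≤ 1 - t / Fintype.card A := by
      by_contra! h
      nlinarith
    refine isFarFromProduct_stateDist hA hs hB0 he he1 heε hε hε3 hρ hγ _ (by linarith) ?_
    calc 1 / 3 ≤ lightFraction B (σ y) * (1 - t / Fintype.card A) - s := by
          linarith [mul_le_mul_of_nonneg_right hℓ hst]
      _ = _ := by ring
  · exact fun z => (stateMixture_zero_pos hB0 hπ hπ' z).trans_eq
      (mixture_stateDist hB0 le_rfl zero_le_one z).symm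
  · rw [← sum_mixture (k := k) _ fun y => stateDist hB0 le_rfl zero_le_one (σ y)]
    simp_rw [mixture_stateDist]
    exact hχ

end Reduction

section UniformNull

theorem sum_sq_sum_prod {Ω R : Type*} [Fintype Ω] [Fintype R] {k : ℕ} (b : R → Ω → ℝ) :
    ∑ y : Fin k → Ω, (∑ r, ∏ s, b r (y s)) ^ 2 = ∑ r, ∑ r', (∑ x, b r x * b r' x) ^ k := by
  simp_rw [sq, sum_mul_sum, ← prod_mul_distrib]
  rw [sum_comm]
  refine sum_congr rfl fun r _ => ?_
  rw [sum_comm]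
  exact sum_congr rfl fun r' _ => (Fintype.sum_pow (fun x => b r x * b r' x) k).symm

theorem sum_exp_mul_bump_zmod_two (x : ℝ) (v : ZMod 2) :
    ∑ v', Real.exp (x * bump 0 v v') = 2 * Real.cosh x := by
  have huniv : (univ : Finset (ZMod 2)) = {v, v + 1} := by revert v; decide
  have hne : v ≠ v + 1 := by revert v; decide
  rw [huniv, sum_pair hne, Real.cosh_eq]
  simp only [bump, ZMod.card]
  norm_num
  ring

variable {ι : Type*} [Fintype ι] [Nonempty ι]

section MeanBump

variable {A : Type*} [AddCommGroup A] [Fintype A] [DecidableEq A]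

theorem one_add_mean_bump_mem_Icc {c : ℝ} (hc : 0 ≤ c) (hc1 : c ≤ 1) (r r' : ι → A) :
    1 + c / Fintype.card ι * ∑ b, bump 0 (r b) (r' b) ∈ Set.Icc 0 (Fintype.card A : ℝ) := by
  have hA : (1 : ℝ) ≤ Fintype.card A := by exact_mod_cast Fintype.card_pos
  have hlow : c / Fintype.card ι * -Fintype.card ι ≤
      c / Fintype.card ι * ∑ b, bump 0 (r b) (r' b) := by
    gcongr
    exact neg_card_le_sum_bump r r'
  have hup : c / Fintype.card ι * ∑ b, bump 0 (r b) (r' b) ≤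
      c / Fintype.card ι * (Fintype.card ι * (Fintype.card A - 1)) := by
    gcongr
    simpa using sum_le_card_nsmul univ (fun b => bump 0 (r b) (r' b)) _ fun b _ => bump_le _ _ _
  have hcancel (x : ℝ) : c / Fintype.card ι * (Fintype.card ι * x) = c * x := by field_simp
  rw [hcancel] at hup
  have hcancel' : c / Fintype.card ι * -(Fintype.card ι : ℝ) = -c := by field_simp
  constructor <;> nlinarith

theorem one_add_mean_bump_pow_le {c : ℝ} (hc : 0 ≤ c) (hc1 : c ≤ 1) (k : ℕ) (r r' : ι → A) :
    (1 + c / Fintype.card ι * ∑ b, bump 0 (r b) (r' b)) ^ k ≤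
      ∏ b, Real.exp (k * c / Fintype.card ι * bump 0 (r b) (r' b)) := by
  calc _ ≤ Real.exp (c / Fintype.card ι * ∑ b, bump 0 (r b) (r' b)) ^ k := by
        have := (one_add_mean_bump_mem_Icc hc hc1 r r').1
        gcongr
        linarith [Real.add_one_le_exp (c / Fintype.card ι * ∑ b, bump 0 (r b) (r' b))]
    _ = _ := by
        rw [← Real.exp_sum, ← mul_sum, ← Real.exp_nat_mul]
        ring_nf

end MeanBump

theorem sum_one_add_mean_bump_pow_le_exp [DecidableEq ι] {c : ℝ} (hc : 0 ≤ c) (hc1 : c ≤ 1) (k : ℕ)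
    (r : ι → ZMod 2) :
    ∑ r' : ι → ZMod 2, (1 + c / Fintype.card ι * ∑ b, bump 0 (r b) (r' b)) ^ k ≤
      Fintype.card (ι → ZMod 2) * Real.exp ((k * c) ^ 2 / (2 * Fintype.card ι)) := by
  set x : ℝ := k * c / Fintype.card ι
  calc _ ≤ ∑ r' : ι → ZMod 2, ∏ b, Real.exp (x * bump 0 (r b) (r' b)) :=
        sum_le_sum fun r' _ => one_add_mean_bump_pow_le hc hc1 k r r'
    _ = 2 ^ Fintype.card ι * Real.cosh x ^ Fintype.card ι := by
        rw [← Fintype.prod_sum fun b v => Real.exp (x * bump 0 (r b) v)]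
        simp_rw [sum_exp_mul_bump_zmod_two, prod_const, card_univ, mul_pow]
    _ ≤ 2 ^ Fintype.card ι * Real.exp (x ^ 2 / 2) ^ Fintype.card ι := by
        gcongr
        exact Real.cosh_le_exp_half_sq x
    _ = _ := by
        rw [← Real.exp_nat_mul, Fintype.card_fun, ZMod.card]
        push_cast
        congr 2
        simp only [x]
        field_simp

variable {Γ κ : Type*} [Fintype Γ] [Fintype κ]

/-- The states in which no row group is heavy and the shifts are those of a sign pattern. -/
def signState (r : Γ × κ → ZMod 2) (g : Γ) : GroupState κ (ZMod 2) := (false, fun J => r (g, J))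

theorem stateMixture_signState_zero [DecidableEq Γ] [DecidableEq κ] {k : ℕ}
    (z : Fin k → Γ × ZMod 2 × κ × ZMod 2) :
    stateMixture 1 0 (fun _ => 1) signState z = Fintype.card (Γ × κ → ZMod 2) := by
  simp [stateMixture, cellWeight, signState]

theorem sum_cellWeight_signState_mul [Nonempty Γ] [Nonempty κ] (B e : ℝ)
    (r r' : Γ × κ → ZMod 2) :
    ∑ ω : Γ × ZMod 2 × κ × ZMod 2,
        cellWeight B e (signState r ω.1) ω.2 * cellWeight B e (signState r' ω.1) ω.2 =
      4 * Fintype.card (Γ × κ) *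
        (1 + e ^ 2 / Fintype.card (Γ × κ) * ∑ b, bump 0 (r b) (r' b)) := by
  rw [Fintype.sum_prod_type, Fintype.sum_prod_type (fun b : Γ × κ => bump 0 (r b) (r' b))]
  simp_rw [signState, sum_cellWeight_light_mul_light, ← mul_sum, sum_add_distrib, ← mul_sum,
    sum_const, card_univ, ZMod.card, nsmul_eq_mul, Fintype.card_prod, Nat.cast_mul]
  field_simp
  norm_num
  ring

theorem sum_stateMixture_signState_sq_div_le [DecidableEq Γ] [DecidableEq κ] [Nonempty Γ]
    [Nonempty κ] {e : ℝ} (he : 0 ≤ e) (he1 : e ≤ 1) (k : ℕ) :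
    ∑ z : Fin k → Γ × ZMod 2 × κ × ZMod 2, stateMixture 1 e (fun _ => 1) signState z ^ 2 /
        stateMixture 1 0 (fun _ => 1) signState z ≤
      Real.exp ((k * e ^ 2) ^ 2 / (2 * Fintype.card (Γ × κ))) *
        ∑ z : Fin k → Γ × ZMod 2 × κ × ZMod 2, stateMixture 1 0 (fun _ => 1) signState z := by
  set R : ℝ := (Fintype.card (Γ × κ → ZMod 2) : ℝ) with hR
  set N : ℝ := (Fintype.card (Γ × κ) : ℝ) with hN
  set x := Real.exp ((k * e ^ 2) ^ 2 / (2 * N))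
  have hRpos : 0 < R := by positivity
  have hsq : ∑ z : Fin k → Γ × ZMod 2 × κ × ZMod 2,
      stateMixture 1 e (fun _ => 1) signState z ^ 2 ≤ (4 * N) ^ k * (R * (R * x)) := by
    simp_rw [stateMixture, one_mul]
    rw [sum_sq_sum_prod fun r (ω : Γ × ZMod 2 × κ × ZMod 2) =>
      cellWeight 1 e (signState r ω.1) ω.2]
    simp_rw [sum_cellWeight_signState_mul, mul_pow _ _ k, ← mul_sum]
    gcongr
    refine (sum_le_sum fun r _ =>
      sum_one_add_mean_bump_pow_le_exp (sq_nonneg e) (pow_le_one₀ he he1) k r).trans_eq ?_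
    rw [sum_const, card_univ, nsmul_eq_mul]
  simp_rw [stateMixture_signState_zero, ← sum_div, ← hR, sum_const, card_univ, nsmul_eq_mul]
  have hcard : (Fintype.card (Fin k → Γ × ZMod 2 × κ × ZMod 2) : ℝ) = (4 * N) ^ k := by
    simp only [Fintype.card_fun, Fintype.card_prod, Fintype.card_fin, ZMod.card, hN, Nat.cast_mul,
      Nat.cast_pow, Nat.cast_ofNat]
    ring
  rw [hcard, div_le_iff₀ hRpos]
  exact hsq.trans_eq (by ring)

end UniformNull

section DirectBound

theorem exists_injective_fin_div (n L : ℕ) [NeZero L] :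
    ∃ ρ : Fin (n / L) × ZMod L → Fin n, Function.Injective ρ := by
  have : Nonempty ((Fin (n / L) × ZMod L) ↪ Fin n) := by
    apply Function.Embedding.nonempty_of_card_le
    simpa [ZMod.card] using Nat.div_mul_le_self n L
  exact ⟨this.some, this.some.injective⟩

theorem quarter_lt_of_le_exp {x : ℝ} (hx : 1.4 ≤ Real.exp x) : 1 / 4 < x := by
  refine Real.exp_lt_exp.1 (lt_of_lt_of_le ?_ hx)
  have hpow : Real.exp (1 / 4) ^ 4 = Real.exp 1 := by rw [← Real.exp_nat_mul]; norm_num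
  refine lt_of_pow_lt_pow_left₀ 4 (by norm_num) ?_
  rw [hpow]
  exact Real.exp_one_lt_d9.trans (by norm_num)

theorem div_three_le_div_two {n : ℕ} (hn : 2 ≤ n) : (n : ℝ) / 3 ≤ (n / 2 : ℕ) := by
  have h : (n : ℝ) ≤ 3 * (n / 2 : ℕ) := by exact_mod_cast (by omega : n ≤ 3 * (n / 2))
  linarith

variable {n m k : ℕ} {α ε : ℝ} {T : Tester n m k}

theorem two_mul_card_lt_of_tester (hT : IsAugmentedIndependenceTester α ε 0.1 T) (hn : 2 ≤ n)
    (hm : 2 ≤ m) (hα : 0 ≤ α) (hε : 0 < ε) (hε3 : ε < 1 / 3) :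
    ((n / 2 : ℕ) * (m / 2 : ℕ) : ℝ) < 2 * (k * min 1 (5 * ε) ^ 2) ^ 2 := by
  obtain ⟨ρ, hρ⟩ := exists_injective_fin_div n 2
  obtain ⟨γ, hγ⟩ := exists_injective_fin_div m 2
  have : Nonempty (Fin (n / 2)) := ⟨⟨0, by omega⟩⟩
  have : Nonempty (Fin (m / 2)) := ⟨⟨0, by omega⟩⟩
  have hheavy (r : Fin (n / 2) × Fin (m / 2) → ZMod 2) : heavyCount (signState r) = 0 := by
    simp [heavyCount, signState]
  have hexp := le_of_stateMixture_chiSq_le hT hε hε3 diagonalOverlapBound_zmod_two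
    (by norm_num) le_rfl rfl hρ hγ hα (by norm_num) (by norm_num)
    (fun _ => zero_le_one) ⟨0, one_pos⟩ (bad := ∅)
    (by simp only [sum_empty, groupMass_eq, hheavy]; positivity)
    (by simp [hheavy]) (sum_stateMixture_signState_sq_div_le (le_min zero_le_one (by linarith))
      (min_le_left _ _) k)
  have hquarter := quarter_lt_of_le_exp hexp
  have hG : 0 < (n / 2 : ℕ) := by omega
  have hM : 0 < (m / 2 : ℕ) := by omega
  rw [Fintype.card_prod, Fintype.card_fin, Fintype.card_fin, Nat.cast_mul,
    div_lt_div_iff₀ (by norm_num) (by positivity)] at hquarter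
  linarith

theorem sqrt_mul_div_sq_le (hT : IsAugmentedIndependenceTester α ε 0.1 T) (hn : 2 ≤ n)
    (hm : 2 ≤ m) (hα : 0 ≤ α) (hε : 0 < ε) (hε3 : ε < 1 / 3) :
    √((n : ℝ) * m) / ε ^ 2 ≤ 110 * k := by
  have hcount := two_mul_card_lt_of_tester hT hn hm hα hε hε3
  have hgroups : (n : ℝ) / 3 * (m / 3) ≤ (n / 2 : ℕ) * (m / 2 : ℕ) := by
    gcongr
    exacts [div_three_le_div_two hn, div_three_le_div_two hm]
  have hstrength : (k * min 1 (5 * ε) ^ 2) ^ 2 ≤ (k * (5 * ε) ^ 2) ^ 2 := by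
    have : 0 ≤ min 1 (5 * ε) := le_min zero_le_one (by linarith)
    gcongr
    exact min_le_right _ _
  rw [div_le_iff₀ (by positivity)]
  refine Real.sqrt_le_iff.2 ⟨by positivity, ?_⟩
  calc (n : ℝ) * m ≤ 18 * (k * (5 * ε) ^ 2) ^ 2 := by linarith
    _ = 11250 * (k * ε ^ 2) ^ 2 := by ring
    _ ≤ 110 ^ 2 * (k * ε ^ 2) ^ 2 := by gcongr; norm_num
    _ = _ := by ring

end DirectBound

section Coordinates

variable {ι β : Type*} [Fintype ι] [DecidableEq ι] [Fintype β]

theorem card_mul_sum_mul (s : ι) (f : β → ℝ) {H : (ι → β) → ℝ}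
    (hH : ∀ y a, H (Function.update y s a) = H y) :
    Fintype.card β * ∑ y : ι → β, f (y s) * H y = (∑ a, f a) * ∑ y, H y := by
  have hswap : Function.Involutive
      fun p : β × (ι → β) => (p.2 s, Function.update p.2 s p.1) := fun p => by simp
  calc Fintype.card β * ∑ y : ι → β, f (y s) * H y
      = ∑ p : β × (ι → β), f (p.2 s) * H p.2 := by
        simp [Fintype.sum_prod_type]
    _ = ∑ p : β × (ι → β), f p.1 * H p.2 :=
        Fintype.sum_bijective _ hswap.bijective _ _ fun p => by rw [hH]
    _ = (∑ a, f a) * ∑ y, H y := by rw [Fintype.sum_prod_type, sum_mul_sum]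

theorem card_mul_sum_sq_sum {u : ι → β → ℝ} (hu : ∀ J, ∑ v, u J v = 0) :
    Fintype.card β * ∑ r : ι → β, (∑ J, u J (r J)) ^ 2 =
      (∑ J, ∑ v, u J v ^ 2) * Fintype.card (ι → β) := by
  have hcov (J J' : ι) : Fintype.card β * ∑ r : ι → β, u J (r J) * u J' (r J') =
      if J' = J then (∑ v, u J v ^ 2) * Fintype.card (ι → β) else 0 := by
    split_ifs with hJ
    · subst hJ
      simpa [← sq] using card_mul_sum_mul J' (fun v => u J' v ^ 2) (H := fun _ => 1) fun _ _ => rfl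
    · rw [card_mul_sum_mul J (u J) (H := fun r => u J' (r J')) fun y a => by
        rw [Function.update_of_ne hJ], hu, zero_mul]
  simp_rw [sq (∑ J, u J _), sum_mul_sum]
  rw [sum_comm, mul_sum, sum_mul]
  refine sum_congr rfl fun J _ => ?_
  rw [sum_comm, mul_sum]
  simp_rw [hcov]
  simp

theorem sum_sum_apply_eq_zero {u : ι → β → ℝ} (hu : ∀ J, ∑ v, u J v = 0) :
    ∑ r : ι → β, ∑ J, u J (r J) = 0 := by
  rw [sum_comm]
  refine sum_eq_zero fun J _ => ?_
  have hmean := card_mul_sum_mul J (u J) (H := fun _ => 1) fun _ _ => rfl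
  simp only [mul_one, hu, zero_mul] at hmean
  rcases mul_eq_zero.1 hmean with hβ | hzero
  · have : IsEmpty β := Fintype.card_eq_zero_iff.1 (by exact_mod_cast hβ)
    exact sum_eq_zero fun r _ => this.elim (r J)
  · exact hzero

end Coordinates

section Counts

variable {Γ : Type*} [DecidableEq Γ] {k : ℕ}

/-- The number of samples that fall into group `g`. -/
def count (y : Fin k → Γ) (g : Γ) : ℕ := #{s | y s = g}

theorem count_update_le (y : Fin k → Γ) (s : Fin k) {g g₀ : Γ} (hg : g ≠ g₀) :
    count (Function.update y s g₀) g ≤ count y g := by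
  refine card_le_card fun x hx => ?_
  simp only [mem_filter, mem_univ, true_and] at hx ⊢
  rcases eq_or_ne x s with rfl | hxs
  · exact absurd (by simpa using hx.symm) hg
  · rwa [Function.update_of_ne hxs] at hx

theorem count_mul_pred_mul (y : Fin k → Γ) (g : Γ) (v : ℝ) :
    (count y g : ℝ) * (count y g - 1) * v = ∑ x ∈ (univ : Finset (Fin k)).offDiag,
      if y x.1 = g then (if y x.2 = g then v else 0) else 0 := by
  have hfilter : (univ : Finset (Fin k)).offDiag.filter (fun x => y x.1 = g ∧ y x.2 = g) =
      (univ.filter fun s => y s = g).offDiag := by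
    ext x
    simp only [mem_filter, mem_offDiag, mem_univ, true_and]
    tauto
  simp_rw [← ite_and]
  rw [← sum_filter, hfilter, sum_const, offDiag_card, nsmul_eq_mul,
    Nat.cast_sub (Nat.le_mul_self _), Nat.cast_mul, count]
  ring

variable [Fintype Γ]

theorem sum_count (y : Fin k → Γ) : ∑ g, count y g = k := by
  simpa [count] using
    (card_eq_sum_card_fiberwise (f := y) (s := univ) (t := univ) (by simp)).symm

theorem prod_pow_count (y : Fin k → Γ) (C : ℝ) : ∏ g, C ^ count y g = C ^ k := by
  rw [prod_pow_eq_pow_sum, sum_count]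

theorem sum_prod_mul_prod_eq_prod_sum {S : Type*} [Fintype S] (π : S → ℝ) (y : Fin k → Γ)
    (b : S → Fin k → ℝ) :
    ∑ σ : Γ → S, (∏ g, π (σ g)) * ∏ s, b (σ (y s)) s =
      ∏ g, ∑ τ, π τ * ∏ s with y s = g, b τ s := by
  rw [Fintype.prod_sum fun g τ => π τ * ∏ s with y s = g, b τ s]
  refine sum_congr rfl fun σ _ => ?_
  rw [prod_mul_distrib, ← prod_fiberwise univ y fun s => b (σ (y s)) s]
  congr 1
  refine prod_congr rfl fun g _ => prod_congr rfl fun s hs => ?_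
  rw [(mem_filter.1 hs).2]

theorem sum_sq_prod_sum_eq_prod_sum {S Cell : Type*} [Fintype S] [Fintype Cell] (π : S → ℝ)
    (a : S → Cell → ℝ) (y : Fin k → Γ) :
    ∑ c : Fin k → Cell, (∏ g, ∑ τ, π τ * ∏ s with y s = g, a τ (c s)) ^ 2 =
      ∏ g, ∑ τ : S × S, π τ.1 * π τ.2 * (∑ x, a τ.1 x * a τ.2 x) ^ count y g := by
  have hsq (c : Fin k → Cell) : (∏ g, ∑ τ, π τ * ∏ s with y s = g, a τ (c s)) ^ 2 =
      ∏ g, ∑ τ : S × S, π τ.1 * π τ.2 * ∏ s with y s = g, a τ.1 (c s) * a τ.2 (c s) := by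
    rw [← prod_pow]
    refine prod_congr rfl fun g _ => ?_
    rw [sq, sum_mul_sum, Fintype.sum_prod_type]
    refine sum_congr rfl fun τ _ => sum_congr rfl fun τ' _ => ?_
    rw [prod_mul_distrib]
    ring
  have hcorr (g : Γ) (τ : S × S) :
      π τ.1 * π τ.2 * (∑ x, a τ.1 x * a τ.2 x) ^ count y g =
        π τ.1 * π τ.2 * ∏ s with y s = g, ∑ x, a τ.1 x * a τ.2 x := by
    rw [prod_const, count]
  simp_rw [hsq, hcorr,
    ← sum_prod_mul_prod_eq_prod_sum (fun τ : S × S => π τ.1 * π τ.2) y fun _ _ => _]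
  rw [sum_comm]
  refine sum_congr rfl fun σ _ => ?_
  rw [← mul_sum, Fintype.prod_sum fun s x => a (σ (y s)).1 x * a (σ (y s)).2 x]

theorem card_mul_sum_ite_le (s : Fin k) (g₀ : Γ) {V : (Fin k → Γ) → ℝ}
    (hV : ∀ y, V (Function.update y s g₀) ≤ V y) :
    Fintype.card Γ * ∑ y, (if y s = g₀ then V y else 0) ≤ ∑ y, V y := by
  have hsplit := card_mul_sum_mul s (fun g => if g = g₀ then (1 : ℝ) else 0)
    (H := fun y => V (Function.update y s g₀)) fun y a => by simp
  have hfactor (y : Fin k → Γ) :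
      (if y s = g₀ then (1 : ℝ) else 0) * V (Function.update y s g₀) =
        if y s = g₀ then V y else 0 := by
    split_ifs with hy
    · rw [← hy, Function.update_eq_self, one_mul]
    · exact zero_mul _
  simp_rw [hfactor, sum_ite_eq', mem_univ, if_true, one_mul] at hsplit
  rw [hsplit]
  exact sum_le_sum fun y _ => hV y

theorem sq_card_mul_sum_ite_ite_le {s s' : Fin k} (hne : s ≠ s') (g₀ : Γ) {V : (Fin k → Γ) → ℝ}
    (hV : ∀ y s, V (Function.update y s g₀) ≤ V y) :
    (Fintype.card Γ : ℝ) ^ 2 *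
      ∑ y, (if y s = g₀ then (if y s' = g₀ then V y else 0) else 0) ≤ ∑ y, V y := by
  have houter := card_mul_sum_ite_le s g₀ (V := fun y => if y s' = g₀ then V y else 0) fun y => by
    rw [Function.update_of_ne hne.symm]
    split_ifs
    exacts [hV y s, le_rfl]
  rw [sq, mul_assoc]
  exact (mul_le_mul_of_nonneg_left houter (Nat.cast_nonneg _)).trans
    (card_mul_sum_ite_le s' g₀ fun y => hV y s')

theorem sum_count_mul_pred_mul_le [Nonempty Γ] (g₀ : Γ) {V : (Fin k → Γ) → ℝ}
    (hV0 : ∀ y, 0 ≤ V y) (hV : ∀ y s, V (Function.update y s g₀) ≤ V y) :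
    ∑ y, (count y g₀ : ℝ) * (count y g₀ - 1) * V y ≤
      (k : ℝ) ^ 2 / (Fintype.card Γ : ℝ) ^ 2 * ∑ y, V y := by
  have hpair : ∀ x ∈ (univ : Finset (Fin k)).offDiag,
      ∑ y : Fin k → Γ, (if y x.1 = g₀ then (if y x.2 = g₀ then V y else 0) else 0) ≤
        (∑ y, V y) / (Fintype.card Γ : ℝ) ^ 2 := by
    intro x hx
    rw [le_div_iff₀ (by positivity), mul_comm]
    exact sq_card_mul_sum_ite_ite_le (mem_offDiag.1 hx).2.2 g₀ hV
  have hk : (#(univ : Finset (Fin k)).offDiag : ℝ) ≤ (k : ℝ) ^ 2 := by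
    rw [offDiag_card, card_univ, Fintype.card_fin, sq]
    exact_mod_cast Nat.sub_le _ _
  simp_rw [count_mul_pred_mul]
  rw [sum_comm]
  refine (sum_le_card_nsmul _ _ _ hpair).trans ?_
  rw [nsmul_eq_mul, ← mul_div_right_comm, ← mul_div_assoc]
  gcongr
  exact sum_nonneg fun y _ => hV0 y

theorem mul_pred_mono : Monotone fun t : ℕ => (t : ℝ) * (t - 1) := by
  refine monotone_nat_of_le_succ fun t => ?_
  push_cast
  nlinarith [(Nat.cast_nonneg t : (0 : ℝ) ≤ t)]

theorem mul_pred_nonneg (t : ℕ) : 0 ≤ (t : ℝ) * (t - 1) := by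
  simpa using mul_pred_mono (Nat.zero_le t)

theorem sum_add_mul_pred_mul_prod_erase_le [Nonempty Γ] {F : Γ → ℕ → ℝ}
    (hF : ∀ g t, 1 / 2 ≤ F g t) (hmono : ∀ g, Monotone (F g)) {x : ℝ} (hx : 0 ≤ x) (g₀ : Γ) :
    ∑ y : Fin k → Γ, (F g₀ (count y g₀) + x * ((count y g₀ : ℝ) * (count y g₀ - 1))) *
        ∏ g ∈ univ.erase g₀, F g (count y g) ≤
      (1 + 2 * x * k ^ 2 / (Fintype.card Γ : ℝ) ^ 2) *
        ∑ y : Fin k → Γ, ∏ g, F g (count y g) := by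
  have hF0 (g : Γ) (t : ℕ) : 0 ≤ F g t := by linarith [hF g t]
  set V : (Fin k → Γ) → ℝ := fun y => ∏ g ∈ univ.erase g₀, F g (count y g)
  have hV0 (y : Fin k → Γ) : 0 ≤ V y := prod_nonneg fun g _ => hF0 g _
  have hupdate (y : Fin k → Γ) (s : Fin k) : V (Function.update y s g₀) ≤ V y :=
    prod_le_prod (fun g _ => hF0 g _) fun g hg =>
      hmono g (count_update_le y s (ne_of_mem_erase hg))
  have herase (y : Fin k → Γ) : F g₀ (count y g₀) * V y = ∏ g, F g (count y g) :=
    mul_prod_erase univ (fun g => F g (count y g)) (mem_univ g₀)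
  have hVle : ∑ y, V y ≤ 2 * ∑ y : Fin k → Γ, ∏ g, F g (count y g) := by
    rw [mul_sum]
    refine sum_le_sum fun y _ => ?_
    rw [← herase]
    nlinarith [mul_le_mul_of_nonneg_right (hF g₀ (count y g₀)) (hV0 y)]
  have hsplit (y : Fin k → Γ) :
      (F g₀ (count y g₀) + x * ((count y g₀ : ℝ) * (count y g₀ - 1))) *
          ∏ g ∈ univ.erase g₀, F g (count y g) =
        ∏ g, F g (count y g) + x * ((count y g₀ : ℝ) * (count y g₀ - 1) * V y) := by
    rw [add_mul, mul_assoc, ← herase]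
  simp_rw [hsplit, sum_add_distrib, ← mul_sum, add_mul, one_mul]
  refine add_le_add_right ?_ _
  calc x * ∑ y, (count y g₀ : ℝ) * (count y g₀ - 1) * V y
      ≤ x * ((k : ℝ) ^ 2 / (Fintype.card Γ : ℝ) ^ 2 *
          (2 * ∑ y : Fin k → Γ, ∏ g, F g (count y g))) := by
        gcongr
        exact (sum_count_mul_pred_mul_le g₀ hV0 hupdate).trans (by gcongr)
    _ = _ := by ring

theorem sum_prod_add_ite_mul_pred_le [Nonempty Γ] {φ : ℕ → ℝ} (hφ : ∀ t, 1 / 2 ≤ φ t)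
    (hmono : Monotone φ) {x : ℝ} (hx : 0 ≤ x) (S : Finset Γ) :
    ∑ y : Fin k → Γ, ∏ g, (φ (count y g) +
        if g ∈ S then x * ((count y g : ℝ) * (count y g - 1)) else 0) ≤
      (1 + 2 * x * k ^ 2 / (Fintype.card Γ : ℝ) ^ 2) ^ #S *
        ∑ y : Fin k → Γ, ∏ g, φ (count y g) := by
  induction S using Finset.induction_on with
  | empty => simp
  | insert g₀ S hg₀ ih =>
    set F : Γ → ℕ → ℝ := fun g t => φ t + if g ∈ S then x * ((t : ℝ) * (t - 1)) else 0
    have hF (g : Γ) (t : ℕ) : 1 / 2 ≤ F g t :=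
      (hφ t).trans (le_add_of_nonneg_right
        (by split_ifs; exacts [mul_nonneg hx (mul_pred_nonneg t), le_rfl]))
    have hFmono (g : Γ) : Monotone (F g) := by
      refine hmono.add ?_
      split_ifs
      exacts [mul_pred_mono.const_mul hx, monotone_const]
    rw [card_insert_of_notMem hg₀, pow_succ', mul_assoc]
    refine le_trans (le_of_eq (sum_congr rfl fun y _ => ?_))
      ((sum_add_mul_pred_mul_prod_erase_le hF hFmono hx g₀).trans
        (mul_le_mul_of_nonneg_left ih (by positivity)))
    rw [← mul_prod_erase univ _ (mem_univ g₀)]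
    congr 1
    · simp [F, hg₀]
    · refine prod_congr rfl fun g hg => ?_
      simp [F, mem_insert, ne_of_mem_erase hg]

theorem sum_prod_add_mul_pred_le [Nonempty Γ] {φ : ℕ → ℝ} (hφ : ∀ t, 1 / 2 ≤ φ t)
    (hmono : Monotone φ) {x : ℝ} (hx : 0 ≤ x) :
    ∑ y : Fin k → Γ, ∏ g, (φ (count y g) + x * ((count y g : ℝ) * (count y g - 1))) ≤
      Real.exp (2 * x * k ^ 2 / Fintype.card Γ) * ∑ y : Fin k → Γ, ∏ g, φ (count y g) := by
  have hall := sum_prod_add_ite_mul_pred_le (k := k) hφ hmono hx (univ : Finset Γ)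
  simp only [mem_univ, if_true, card_univ] at hall
  refine hall.trans (mul_le_mul_of_nonneg_right ?_ (sum_nonneg fun y _ =>
    prod_nonneg fun g _ => by linarith [hφ (count y g)]))
  set w := 2 * x * k ^ 2 / (Fintype.card Γ : ℝ) ^ 2 with hw
  calc (1 + w) ^ Fintype.card Γ ≤ Real.exp w ^ Fintype.card Γ := by
        have : 0 ≤ w := by positivity
        gcongr
        linarith [Real.add_one_le_exp w]
    _ = _ := by
        rw [← Real.exp_nat_mul, hw]
        congr 1
        field_simp

end Counts

section PairMoments

theorem one_add_pow_le {x L : ℝ} (hx : 0 ≤ 1 + x) (hxL : 1 + x ≤ L) (hL : 1 ≤ L) (t : ℕ) :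
    (1 + x) ^ t ≤ 1 + t * x + t * (t - 1) * L ^ t * x ^ 2 := by
  induction t with
  | zero => simp
  | succ t ih =>
    have hLt : 1 ≤ L ^ (t + 1) := one_le_pow₀ hL
    have hquad : (t : ℝ) * (t - 1) * L ^ t * x ^ 2 * (1 + x) ≤
        t * (t - 1) * L ^ (t + 1) * x ^ 2 := by
      have : 0 ≤ (t : ℝ) * (t - 1) * L ^ t * x ^ 2 := by
        have := mul_pred_nonneg t
        positivity
      exact (mul_le_mul_of_nonneg_left hxL this).trans_eq (by ring)
    have hlin : (t : ℝ) * x ^ 2 ≤ 2 * t * L ^ (t + 1) * x ^ 2 := by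
      have : 0 ≤ (t : ℝ) * x ^ 2 := by positivity
      nlinarith
    calc (1 + x) ^ (t + 1) ≤ (1 + t * x + t * (t - 1) * L ^ t * x ^ 2) * (1 + x) := by
          rw [pow_succ]
          gcongr
      _ ≤ 1 + (t + 1) * x + (t + 1) * t * L ^ (t + 1) * x ^ 2 := by linarith
      _ = _ := by push_cast; ring

theorem sum_arrow_prod {Γ Cell : Type*} [Fintype Γ] [Fintype Cell] {k : ℕ}
    (F : (Fin k → Γ × Cell) → ℝ) :
    ∑ z, F z = ∑ y : Fin k → Γ, ∑ c : Fin k → Cell, F fun s => (y s, c s) := by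
  rw [← Equiv.sum_comp (Equiv.arrowProdEquivProdArrow (Fin k) (fun _ => Γ) (fun _ => Cell)).symm F,
    Fintype.sum_prod_type]
  rfl

variable {ι A : Type*} [Fintype ι] [DecidableEq ι] [AddCommGroup A] [Fintype A] [DecidableEq A]

theorem sum_sq_sum_bump (r : ι → A) :
    ∑ r' : ι → A, (∑ b, bump 0 (r b) (r' b)) ^ 2 =
      Fintype.card ι * (Fintype.card A - 1) * Fintype.card (ι → A) := by
  have hL : (Fintype.card A : ℝ) ≠ 0 := by exact_mod_cast Fintype.card_ne_zero
  have hpeak : bump (0 : A) 0 0 = Fintype.card A - 1 := by simpa using bump_add (0 : A) 0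
  have hsq := card_mul_sum_sq_sum (u := fun b v => bump 0 (r b) v) fun b => sum_bump 0 (r b)
  simp only [sq (bump _ _ _), sum_bump_mul_bump, sum_const, card_univ, nsmul_eq_mul, hpeak] at hsq
  refine mul_left_cancel₀ hL (hsq.trans ?_)
  ring

theorem sum_one_add_mean_bump_pow_le [Nonempty ι] {c : ℝ} (hc : 0 ≤ c) (hc1 : c ≤ 1) (t : ℕ)
    (r : ι → A) :
    ∑ r' : ι → A, (1 + c / Fintype.card ι * ∑ b, bump 0 (r b) (r' b)) ^ t ≤
      Fintype.card (ι → A) * (1 + t * (t - 1) * (Fintype.card A : ℝ) ^ t *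
        (c ^ 2 * Fintype.card A / Fintype.card ι)) := by
  have hmean := sum_sum_apply_eq_zero (u := fun b v => bump 0 (r b) v) fun b => sum_bump 0 (r b)
  have hsq := sum_sq_sum_bump r
  have hL : (1 : ℝ) ≤ Fintype.card A := by exact_mod_cast Fintype.card_pos
  have hN : (0 : ℝ) < Fintype.card ι := by exact_mod_cast Fintype.card_pos
  set L : ℝ := (Fintype.card A : ℝ)
  set N : ℝ := (Fintype.card ι : ℝ)
  have hpred := mul_pred_nonneg t
  calc _ ≤ ∑ r' : ι → A, (1 + t * (c / N * ∑ b, bump 0 (r b) (r' b)) +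
        t * (t - 1) * L ^ t * (c / N * ∑ b, bump 0 (r b) (r' b)) ^ 2) :=
        sum_le_sum fun r' _ => one_add_pow_le (one_add_mean_bump_mem_Icc hc hc1 r r').1
          (one_add_mean_bump_mem_Icc hc hc1 r r').2 hL t
    _ = Fintype.card (ι → A) * (1 + t * (t - 1) * L ^ t * (c ^ 2 * (L - 1) / N)) := by
        simp_rw [mul_pow (c / N), sum_add_distrib, ← mul_sum, hmean, hsq, sum_const, card_univ,
          nsmul_eq_mul]
        field_simp
        ring
    _ ≤ _ := by
        gcongr
        linarith

end PairMoments

section Prior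

variable {A κ : Type*} [Fintype A] [Fintype κ] [DecidableEq κ]

/-- The prior on the state of a row group: heavy with probability `η`, and an independent uniform
shift for every column block. -/
noncomputable def prior (η : ℝ) (τ : GroupState κ A) : ℝ :=
  (if τ.1 then η else 1 - η) / Fintype.card (κ → A)

/-- The expectation of `Y ^ t` for a mass `Y` that is `B` with probability `η` and `1` otherwise:
the likelihood of `t` samples in a row group under the null hypothesis. -/
noncomputable def mixFactor (η B : ℝ) (t : ℕ) : ℝ := 1 - η + η * B ^ t

theorem prior_nonneg {η : ℝ} (hη0 : 0 ≤ η) (hη1 : η ≤ 1) (τ : GroupState κ A) : 0 ≤ prior η τ := by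
  unfold prior
  refine div_nonneg ?_ (Nat.cast_nonneg _)
  split_ifs <;> linarith

theorem sum_prior_mul [Nonempty A] (η : ℝ) (F : Bool → ℝ) :
    ∑ τ : GroupState κ A, prior η τ * F τ.1 = η * F true + (1 - η) * F false := by
  have hR : (Fintype.card (κ → A) : ℝ) ≠ 0 := by positivity
  simp only [Fintype.sum_prod_type, Fintype.sum_bool, prior, if_true, Bool.false_eq_true, if_false,
    sum_const, card_univ, nsmul_eq_mul]
  field_simp

theorem mixFactor_ge_half {η B : ℝ} (hη0 : 0 ≤ η) (hη : η ≤ 1 / 2) (hB : 0 ≤ B) (t : ℕ) :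
    1 / 2 ≤ mixFactor η B t := by
  have : 0 ≤ η * B ^ t := by positivity
  unfold mixFactor
  linarith

theorem mixFactor_mono {η B : ℝ} (hη0 : 0 ≤ η) (hB : 1 ≤ B) : Monotone (mixFactor η B) :=
  fun _ _ h => add_le_add le_rfl (mul_le_mul_of_nonneg_left (pow_le_pow_right₀ hB h) hη0)

-- A group that receives at most one sample carries no information; beyond that the growth
-- `L ^ t` of the correlations is absorbed by the term `η * B ^ t` of the null hypothesis.
theorem mul_pred_mul_pow_div_mixFactor_le {η B L D : ℝ} (hη0 : 0 < η) (hη1 : η ≤ 1) (hL : 0 ≤ L)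
    (hLB : L ≤ B) (hB : 0 < B) (hD : 0 ≤ D) (t : ℕ) :
    t * (t - 1) * L ^ t * D / mixFactor η B t ≤ (L / B) ^ 2 * D / η * (t * (t - 1)) := by
  have hpred := mul_pred_nonneg t
  have hφ : η * B ^ t ≤ mixFactor η B t := by unfold mixFactor; linarith
  calc _ ≤ t * (t - 1) * L ^ t * D / (η * B ^ t) := by gcongr
    _ = (L / B) ^ t * D / η * (t * (t - 1)) := by
        rw [div_pow]
        field_simp
    _ ≤ _ := by
        rcases lt_or_ge t 2 with ht | ht
        · have hzero : (t : ℝ) * (t - 1) = 0 := by interval_cases t <;> simp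
          rw [hzero, mul_zero, mul_zero]
        · have := pow_le_pow_of_le_one (by positivity) ((div_le_one hB).2 hLB) ht
          gcongr

variable [AddCommGroup A] [DecidableEq A]

theorem sum_prior_mul_prod_cellWeight_zero {k : ℕ} {Γ : Type*} [DecidableEq Γ]
    (η B : ℝ) (y : Fin k → Γ) (c : Fin k → A × κ × A) (g : Γ) :
    ∑ τ, prior η τ * ∏ s with y s = g, cellWeight B 0 τ (c s) = mixFactor η B (count y g) := by
  simp_rw [cellWeight_zero, prod_const]
  refine (sum_prior_mul η fun b => (if b then B else 1) ^ count y g).trans ?_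
  simp only [if_true, Bool.false_eq_true, if_false, one_pow, mixFactor]
  ring

theorem sum_prior_mul_sum_cellWeight_heavy_pow (η B e : ℝ) (r : κ → A) (t : ℕ) :
    ∑ τ, prior η τ * (∑ c, cellWeight B e (true, r) c * cellWeight B e τ c) ^ t =
      ((Fintype.card A : ℝ) ^ 2 * Fintype.card κ) ^ t * (B ^ t * mixFactor η B t) := by
  simp_rw [sum_cellWeight_heavy_mul_cellWeight]
  refine (sum_prior_mul η fun b => ((Fintype.card A : ℝ) ^ 2 * Fintype.card κ *
    (B * if b then B else 1)) ^ t).trans ?_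
  simp only [if_true, Bool.false_eq_true, if_false, mixFactor, mul_pow, one_pow]
  ring

theorem sum_prior_mul_sum_cellWeight_light_pow_le [Nonempty κ] {η e : ℝ} (B : ℝ) (hη0 : 0 ≤ η)
    (hη1 : η ≤ 1) (he : 0 ≤ e) (he1 : e ≤ 1) (r : κ → A) (t : ℕ) :
    ∑ τ, prior η τ * (∑ c, cellWeight B e (false, r) c * cellWeight B e τ c) ^ t ≤
      ((Fintype.card A : ℝ) ^ 2 * Fintype.card κ) ^ t * (mixFactor η B t +
        t * (t - 1) * (Fintype.card A : ℝ) ^ t * (e ^ 4 * Fintype.card A / Fintype.card κ)) := by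
  set C : ℝ := (Fintype.card A : ℝ) ^ 2 * Fintype.card κ
  set q : ℝ := t * (t - 1) * (Fintype.card A : ℝ) ^ t * (e ^ 4 * Fintype.card A / Fintype.card κ)
    with hq
  have hq0 : 0 ≤ q := by
    have := mul_pred_nonneg t
    positivity
  set R : ℝ := (Fintype.card (κ → A) : ℝ) with hR
  have hRpos : 0 < R := by positivity
  have hheavy (r' : κ → A) :
      ∑ c, cellWeight B e (false, r) c * cellWeight B e (true, r') c = C * B := by
    simp_rw [mul_comm (cellWeight B e (false, r) _), sum_cellWeight_heavy_mul_cellWeight]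
    simp [C]
  have hlight : ∑ r' : κ → A, (1 + e ^ 2 / Fintype.card κ * ∑ J, bump 0 (r J) (r' J)) ^ t ≤
      R * (1 + q) := by
    rw [hq, show e ^ 4 = (e ^ 2) ^ 2 by ring]
    exact sum_one_add_mean_bump_pow_le (sq_nonneg e) (pow_le_one₀ he he1) t r
  have hcorr (r' : κ → A) : ∑ c, cellWeight B e (false, r) c * cellWeight B e (false, r') c =
      C * (1 + e ^ 2 / Fintype.card κ * ∑ J, bump 0 (r J) (r' J)) :=
    sum_cellWeight_light_mul_light B e r r'
  simp only [Fintype.sum_prod_type (fun _ : GroupState κ A => _ * _ ^ t), Fintype.sum_bool, prior,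
    if_true, Bool.false_eq_true, if_false, hheavy, hcorr, mul_pow C, ← mul_sum, sum_const,
    card_univ, nsmul_eq_mul, ← hR]
  calc _ ≤ η / R * (C ^ t * (R * B ^ t)) + (1 - η) / R * (C ^ t * (R * (1 + q))) := by
        have : 0 ≤ 1 - η := by linarith
        gcongr
    _ = C ^ t * (mixFactor η B t + (1 - η) * q) := by
        unfold mixFactor
        field_simp
        ring
    _ ≤ _ := by
        gcongr
        nlinarith

theorem sum_prior_mul_prior_mul_pow_le [Nonempty κ] {η e : ℝ} (B : ℝ) (hη0 : 0 ≤ η) (hη1 : η ≤ 1)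
    (he : 0 ≤ e) (he1 : e ≤ 1) (t : ℕ) :
    ∑ τ : GroupState κ A × GroupState κ A, prior η τ.1 * prior η τ.2 *
        (∑ c, cellWeight B e τ.1 c * cellWeight B e τ.2 c) ^ t ≤
      ((Fintype.card A : ℝ) ^ 2 * Fintype.card κ) ^ t * (mixFactor η B t ^ 2 +
        t * (t - 1) * (Fintype.card A : ℝ) ^ t * (e ^ 4 * Fintype.card A / Fintype.card κ)) := by
  set C : ℝ := (Fintype.card A : ℝ) ^ 2 * Fintype.card κ
  set q : ℝ := t * (t - 1) * (Fintype.card A : ℝ) ^ t * (e ^ 4 * Fintype.card A / Fintype.card κ)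
  have hq : 0 ≤ q := by
    have := mul_pred_nonneg t
    positivity
  have hinner (τ : GroupState κ A) :
      ∑ τ', prior η τ' * (∑ c, cellWeight B e τ c * cellWeight B e τ' c) ^ t ≤
        C ^ t * if τ.1 then B ^ t * mixFactor η B t else mixFactor η B t + q := by
    obtain ⟨b, r⟩ := τ
    cases b
    · exact sum_prior_mul_sum_cellWeight_light_pow_le B hη0 hη1 he he1 r t
    · exact (sum_prior_mul_sum_cellWeight_heavy_pow η B e r t).le
  simp_rw [Fintype.sum_prod_type (fun _ : GroupState κ A × GroupState κ A => _ * _ ^ t), mul_assoc,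
    ← mul_sum]
  calc _ ≤ ∑ τ : GroupState κ A, prior η τ *
        (C ^ t * if τ.1 then B ^ t * mixFactor η B t else mixFactor η B t + q) :=
        sum_le_sum fun τ _ => mul_le_mul_of_nonneg_left (hinner τ) (prior_nonneg hη0 hη1 τ)
    _ = C ^ t * (mixFactor η B t ^ 2 + (1 - η) * q) := by
        refine (sum_prior_mul η fun b =>
          C ^ t * if b then B ^ t * mixFactor η B t else mixFactor η B t + q).trans ?_
        simp only [if_true, Bool.false_eq_true, if_false, mixFactor]
        ring
    _ ≤ _ := by
        gcongr
        nlinarith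

end Prior

section HeavyNull

variable {Γ A κ : Type*} [Fintype Γ] [DecidableEq Γ] [Fintype A] [Fintype κ] [DecidableEq κ]
  {k : ℕ}

/-- The weight of a family of states under which the row groups are independent and follow the
prior. -/
noncomputable def priorWeight (η : ℝ) (σ : Γ → GroupState κ A) : ℝ := ∏ g, prior η (σ g)

variable [AddCommGroup A] [DecidableEq A]

theorem stateMixture_priorWeight (η B e : ℝ) (z : Fin k → Γ × A × κ × A) :
    stateMixture B e (priorWeight η) id z =
      ∏ g, ∑ τ, prior η τ * ∏ s with (z s).1 = g, cellWeight B e τ (z s).2 :=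
  sum_prod_mul_prod_eq_prod_sum (prior η) (fun s => (z s).1) fun τ s => cellWeight B e τ (z s).2

theorem stateMixture_priorWeight_zero (η B : ℝ) (z : Fin k → Γ × A × κ × A) :
    stateMixture B 0 (priorWeight η) id z = ∏ g, mixFactor η B (count (fun s => (z s).1) g) := by
  rw [stateMixture_priorWeight]
  exact prod_congr rfl fun g _ =>
    sum_prior_mul_prod_cellWeight_zero η B (fun s => (z s).1) (fun s => (z s).2) g

theorem sum_stateMixture_priorWeight_zero (η B : ℝ) :
    ∑ z : Fin k → Γ × A × κ × A, stateMixture B 0 (priorWeight η) id z =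
      ((Fintype.card A : ℝ) ^ 2 * Fintype.card κ) ^ k *
        ∑ y : Fin k → Γ, ∏ g, mixFactor η B (count y g) := by
  simp_rw [stateMixture_priorWeight_zero]
  rw [sum_arrow_prod, mul_sum]
  refine sum_congr rfl fun y _ => ?_
  simp only [sum_const, card_univ, nsmul_eq_mul, Fintype.card_fun, Fintype.card_prod,
    Fintype.card_fin, Nat.cast_pow, Nat.cast_mul]
  ring

theorem sum_stateMixture_priorWeight_sq_div_le_of_rows [Nonempty κ] {η B e : ℝ} (hη0 : 0 < η)
    (hη : η ≤ 1 / 2) (hB : (Fintype.card A : ℝ) ≤ B) (he : 0 ≤ e) (he1 : e ≤ 1) (y : Fin k → Γ) :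
    ∑ c : Fin k → A × κ × A, stateMixture B e (priorWeight η) id (fun s => (y s, c s)) ^ 2 /
        stateMixture B 0 (priorWeight η) id (fun s => (y s, c s)) ≤
      ((Fintype.card A : ℝ) ^ 2 * Fintype.card κ) ^ k *
        ∏ g, (mixFactor η B (count y g) + (Fintype.card A / B) ^ 2 *
          (e ^ 4 * Fintype.card A / Fintype.card κ) / η *
            ((count y g : ℝ) * (count y g - 1))) := by
  have hL : (0 : ℝ) < Fintype.card A := by exact_mod_cast Fintype.card_pos
  have hB0 : 0 < B := hL.trans_le hB
  set C : ℝ := (Fintype.card A : ℝ) ^ 2 * Fintype.card κ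
  set D : ℝ := e ^ 4 * Fintype.card A / Fintype.card κ
  have hD : 0 ≤ D := by positivity
  have hφ (g : Γ) : 0 < mixFactor η B (count y g) := by
    linarith [mixFactor_ge_half hη0.le hη hB0.le (count y g)]
  have hcell (τ : GroupState κ A) (c : A × κ × A) : 0 ≤ cellWeight B e τ c :=
    cellWeight_nonneg hB0.le he he1 τ c
  have hprior (τ : GroupState κ A) : 0 ≤ prior η τ := prior_nonneg hη0.le (by linarith) τ
  simp_rw [stateMixture_priorWeight_zero, ← sum_div, stateMixture_priorWeight]
  rw [sum_sq_prod_sum_eq_prod_sum, ← prod_div_distrib, ← prod_pow_count y C, ← prod_mul_distrib]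
  refine prod_le_prod (fun g _ => ?_) fun g _ => ?_
  · exact div_nonneg (sum_nonneg fun τ _ => mul_nonneg (mul_nonneg (hprior _) (hprior _))
      (pow_nonneg (sum_nonneg fun c _ => mul_nonneg (hcell _ c) (hcell _ c)) _)) (hφ g).le
  · set t := count y g
    have hφt := hφ g
    calc _ ≤ C ^ t * (mixFactor η B t ^ 2 + t * (t - 1) * (Fintype.card A : ℝ) ^ t * D) /
          mixFactor η B t := by
          gcongr
          exact sum_prior_mul_prior_mul_pow_le B hη0.le (by linarith) he he1 t
      _ = C ^ t * (mixFactor η B t +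
          t * (t - 1) * (Fintype.card A : ℝ) ^ t * D / mixFactor η B t) := by field_simp
      _ ≤ _ := by
          gcongr
          exact mul_pred_mul_pow_div_mixFactor_le hη0 (by linarith) hL.le hB hB0 hD t

theorem sum_stateMixture_priorWeight_sq_div_le [Nonempty Γ] [Nonempty κ] {η B e : ℝ} (hη0 : 0 < η)
    (hη : η ≤ 1 / 2) (hB : (Fintype.card A : ℝ) ≤ B) (he : 0 ≤ e) (he1 : e ≤ 1) :
    ∑ z : Fin k → Γ × A × κ × A, stateMixture B e (priorWeight η) id z ^ 2 /
        stateMixture B 0 (priorWeight η) id z ≤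
      Real.exp (2 * ((Fintype.card A / B) ^ 2 *
          (e ^ 4 * Fintype.card A / Fintype.card κ) / η) * k ^ 2 / Fintype.card Γ) *
        ∑ z : Fin k → Γ × A × κ × A, stateMixture B 0 (priorWeight η) id z := by
  have hL : (1 : ℝ) ≤ Fintype.card A := by exact_mod_cast Fintype.card_pos
  rw [sum_stateMixture_priorWeight_zero, sum_arrow_prod]
  refine (sum_le_sum fun y _ =>
    sum_stateMixture_priorWeight_sq_div_le_of_rows hη0 hη hB he he1 y).trans ?_
  rw [← mul_sum, mul_left_comm]
  gcongr
  exact sum_prod_add_mul_pred_le (mixFactor_ge_half hη0.le hη (by linarith))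
    (mixFactor_mono hη0.le (hL.trans hB)) (by positivity)

end HeavyNull

section HeavyCount

variable {Γ A κ : Type*} [Fintype Γ] {η B : ℝ} {k : ℕ}

theorem groupMass_pow_le [Nonempty Γ] (hB : 1 ≤ B) (hk : k * B ≤ Fintype.card Γ)
    (σ : Γ → GroupState κ A) :
    groupMass B σ ^ k ≤ (Fintype.card Γ : ℝ) ^ k * Real.exp (heavyCount σ) := by
  have hmass := groupMass_pos (one_pos.trans_le hB) σ
  set G : ℝ := (Fintype.card Γ : ℝ)
  set N : ℝ := (heavyCount σ : ℝ)
  have hG : 0 < G := by positivity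
  have hN0 : 0 ≤ N := Nat.cast_nonneg _
  have hmass_le : groupMass B σ ≤ G * Real.exp (B * N / G) := by
    calc groupMass B σ = G + (B - 1) * N := groupMass_eq B σ
      _ ≤ G + B * N := by linarith
      _ = G * (B * N / G + 1) := by field_simp; ring
      _ ≤ _ := by
          gcongr
          exact Real.add_one_le_exp _
  calc groupMass B σ ^ k ≤ (G * Real.exp (B * N / G)) ^ k := by gcongr
    _ = G ^ k * Real.exp (k * B / G * N) := by
        rw [mul_pow, ← Real.exp_nat_mul]
        congr 2
        ring
    _ ≤ _ := by
        gcongr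
        exact mul_le_of_le_one_left hN0 ((div_le_one hG).2 hk)

theorem exp_neg_ten_mul_mul_exp_le {h : ℝ} (hh : 1 ≤ h) :
    Real.exp (-(10 * h)) * Real.exp (h * (Real.exp 2 - 1)) ≤ 0.1 := by
  have hexp2 : Real.exp 2 ≤ 8 := by
    calc Real.exp 2 = Real.exp 1 ^ 2 := by rw [← Real.exp_nat_mul]; norm_num
      _ ≤ 2.72 ^ 2 := by gcongr; exact Real.exp_one_lt_d9.le.trans (by norm_num)
      _ ≤ 8 := by norm_num
  have hexp3 : 10 ≤ Real.exp 3 := by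
    calc (10 : ℝ) ≤ 2.7 ^ 3 := by norm_num
      _ ≤ Real.exp 1 ^ 3 := by gcongr; exact le_trans (by norm_num) Real.exp_one_gt_d9.le
      _ = Real.exp 3 := by rw [← Real.exp_nat_mul]; norm_num
  rw [← Real.exp_add]
  calc _ ≤ Real.exp (-3) := Real.exp_le_exp.2 (by nlinarith)
    _ = (Real.exp 3)⁻¹ := Real.exp_neg 3
    _ ≤ (10 : ℝ)⁻¹ := by gcongr
    _ = 0.1 := by norm_num

variable [Fintype A] [Fintype κ] [DecidableEq κ]

theorem priorWeight_nonneg (hη0 : 0 ≤ η) (hη1 : η ≤ 1) (σ : Γ → GroupState κ A) :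
    0 ≤ priorWeight η σ :=
  prod_nonneg fun _ _ => prior_nonneg hη0 hη1 _

variable [Nonempty A]

theorem sum_priorWeight [DecidableEq Γ] (η : ℝ) :
    ∑ σ : Γ → GroupState κ A, priorWeight η σ = 1 := by
  have hprior : ∑ τ : GroupState κ A, prior η τ = 1 := by
    simpa using sum_prior_mul (κ := κ) (A := A) η fun _ => 1
  unfold priorWeight
  rw [← Fintype.prod_sum fun (_ : Γ) (τ : GroupState κ A) => prior η τ]
  simp [hprior]

theorem exists_priorWeight_pos (η : ℝ) : ∃ σ : Γ → GroupState κ A, 0 < priorWeight η σ := by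
  classical
  have hsum := sum_priorWeight (Γ := Γ) (κ := κ) (A := A) η
  obtain ⟨σ, -, hσ⟩ := exists_lt_of_sum_lt (s := univ) (f := fun _ : Γ → GroupState κ A => (0 : ℝ))
    (g := priorWeight η) (by rw [hsum, sum_const_zero]; exact one_pos)
  exact ⟨σ, hσ⟩

theorem sum_priorWeight_mul_exp_le [DecidableEq Γ] (hη0 : 0 ≤ η) :
    ∑ σ : Γ → GroupState κ A, priorWeight η σ * Real.exp (2 * heavyCount σ) ≤
      Real.exp (η * Fintype.card Γ * (Real.exp 2 - 1)) := by
  have hfactor (σ : Γ → GroupState κ A) : priorWeight η σ * Real.exp (2 * heavyCount σ) =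
      ∏ g, (prior η (σ g) * if (σ g).1 then Real.exp 2 else 1) := by
    rw [prod_mul_distrib, prod_ite, prod_const, prod_const_one, mul_one, ← Real.exp_nat_mul,
      mul_comm 2]
    rfl
  have hgroup : ∑ τ : GroupState κ A, prior η τ * (if τ.1 then Real.exp 2 else 1) =
      η * (Real.exp 2 - 1) + 1 := by
    refine (sum_prior_mul η fun b => if b then Real.exp 2 else 1).trans ?_
    simp only [if_true, Bool.false_eq_true, if_false]
    ring
  simp_rw [hfactor]
  rw [← Fintype.prod_sum fun (_ : Γ) (τ : GroupState κ A) =>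
    prior η τ * if τ.1 then Real.exp 2 else 1]
  simp_rw [hgroup, prod_const, card_univ]
  calc _ ≤ Real.exp (η * (Real.exp 2 - 1)) ^ Fintype.card Γ := by
        have : 0 ≤ η * (Real.exp 2 - 1) :=
          mul_nonneg hη0 (by linarith [Real.add_one_le_exp (2 : ℝ)])
        gcongr
        exact Real.add_one_le_exp _
    _ = _ := by
        rw [← Real.exp_nat_mul]
        ring_nf

theorem card_pow_le_sum_priorWeight_mul [DecidableEq Γ] (hη0 : 0 ≤ η) (hη1 : η ≤ 1) (hB : 1 ≤ B)
    (k : ℕ) :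
    (Fintype.card Γ : ℝ) ^ k ≤
      ∑ σ : Γ → GroupState κ A, priorWeight η σ * groupMass B σ ^ k := by
  calc (Fintype.card Γ : ℝ) ^ k
      = ∑ σ : Γ → GroupState κ A, priorWeight η σ * (Fintype.card Γ : ℝ) ^ k := by
        rw [← sum_mul, sum_priorWeight, one_mul]
    _ ≤ _ := sum_le_sum fun σ _ => mul_le_mul_of_nonneg_left
        (pow_le_pow_left₀ (Nat.cast_nonneg _) (card_le_groupMass hB σ) k)
        (priorWeight_nonneg hη0 hη1 σ)

-- A Chernoff bound at exponent 2, of which the factor `groupMass ^ k` takes away 1.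
theorem sum_priorWeight_mul_groupMass_pow_le [Nonempty Γ] (hη0 : 0 ≤ η) (hη1 : η ≤ 1) (hB : 1 ≤ B)
    (hk : k * B ≤ Fintype.card Γ) {a : ℝ} {bad : Finset (Γ → GroupState κ A)}
    (hbad : ∀ σ ∈ bad, 10 * a ≤ heavyCount σ) :
    ∑ σ ∈ bad, priorWeight η σ * groupMass B σ ^ k ≤ (Fintype.card Γ : ℝ) ^ k *
      (Real.exp (-(10 * a)) * Real.exp (η * Fintype.card Γ * (Real.exp 2 - 1))) := by
  classical
  set G : ℝ := (Fintype.card Γ : ℝ)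
  have hweight := priorWeight_nonneg (Γ := Γ) (κ := κ) (A := A) hη0 hη1
  have hterm : ∀ σ ∈ bad, priorWeight η σ * groupMass B σ ^ k ≤
      G ^ k * Real.exp (-(10 * a)) * (priorWeight η σ * Real.exp (2 * heavyCount σ)) := by
    intro σ hσ
    have hexp : Real.exp (heavyCount σ) ≤ Real.exp (-(10 * a)) * Real.exp (2 * heavyCount σ) := by
      rw [← Real.exp_add]
      exact Real.exp_le_exp.2 (by linarith [hbad σ hσ])
    calc _ ≤ priorWeight η σ * (G ^ k * (Real.exp (-(10 * a)) * Real.exp (2 * heavyCount σ))) := by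
          refine mul_le_mul_of_nonneg_left ((groupMass_pow_le hB hk σ).trans ?_) (hweight σ)
          gcongr
      _ = _ := by ring
  calc _ ≤ ∑ σ ∈ bad, G ^ k * Real.exp (-(10 * a)) *
        (priorWeight η σ * Real.exp (2 * heavyCount σ)) := sum_le_sum hterm
    _ ≤ ∑ σ, G ^ k * Real.exp (-(10 * a)) * (priorWeight η σ * Real.exp (2 * heavyCount σ)) :=
        sum_le_sum_of_subset_of_nonneg (subset_univ _) fun σ _ _ =>
          mul_nonneg (by positivity) (mul_nonneg (hweight σ) (Real.exp_nonneg _))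
    _ ≤ _ := by
        rw [← mul_sum, mul_assoc]
        gcongr
        exact sum_priorWeight_mul_exp_le hη0

theorem sum_bad_priorWeight_mul_groupMass_pow_le [DecidableEq Γ] [Nonempty Γ] (hη0 : 0 ≤ η)
    (hη1 : η ≤ 1) (hB : 1 ≤ B) (hk : k * B ≤ Fintype.card Γ) (hcount : 1 ≤ η * Fintype.card Γ)
    {bad : Finset (Γ → GroupState κ A)}
    (hbad : ∀ σ ∈ bad, 10 * (η * Fintype.card Γ) ≤ heavyCount σ) :
    ∑ σ ∈ bad, priorWeight η σ * groupMass B σ ^ k ≤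
      0.1 * ∑ σ : Γ → GroupState κ A, priorWeight η σ * groupMass B σ ^ k := by
  calc _ ≤ _ := sum_priorWeight_mul_groupMass_pow_le hη0 hη1 hB hk hbad
    _ ≤ (Fintype.card Γ : ℝ) ^ k * 0.1 := by
        gcongr
        exact exp_neg_ten_mul_mul_exp_le hcount
    _ ≤ _ := by
        rw [mul_comm]
        gcongr
        exact card_pow_le_sum_priorWeight_mul hη0 hη1 hB k

end HeavyCount

section MaskingBound

theorem masking_exponent_le {G M α k k₀ e ε : ℝ} (hG : 0 < G) (hM : 0 < M) (hα : 0 < α)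
    (hk : 0 ≤ k) (hkk₀ : k ≤ k₀) (hk₀ : 0 < k₀) (he : 0 ≤ e) (heε : e ≤ 5 * ε) :
    2 * ((4 / (G / k₀)) ^ 2 * (e ^ 4 * 4 / M) / (α * k₀ / (100 * G))) * k ^ 2 / G ≤
      8000000 * ε ^ 4 * k₀ ^ 3 / (α * M * G ^ 2) := by
  calc _ = 12800 * (e ^ 4 * k ^ 2) * k₀ / (α * M * G ^ 2) := by
        field_simp
        ring
    _ ≤ 12800 * ((5 * ε) ^ 4 * k₀ ^ 2) * k₀ / (α * M * G ^ 2) := by gcongr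
    _ = _ := by ring

variable {n m k : ℕ} {α ε : ℝ} {T : Tester n m k}

-- The blocks are copies of `ZMod 4` because the rows of a heavy group, whose total mass may be of
-- order `α`, are lost for the distance from product: with `ZMod 2` blocks the constant `1 / 3`
-- leaves no room for this loss.
theorem le_exp_of_masking {k₀ : ℝ} (hT : IsAugmentedIndependenceTester α ε 0.1 T) (hn : 4 ≤ n)
    (hm : 4 ≤ m) (hα : 0 < α) (hα1 : α ≤ 1) (hε : 0 < ε) (hε3 : ε < 1 / 3) (hk : k ≤ k₀)
    (hk₀ : 4 * k₀ ≤ (n / 4 : ℕ)) (hheavy : 100 ≤ α * k₀) :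
    1.4 ≤ Real.exp (8000000 * ε ^ 4 * k₀ ^ 3 / (α * (m / 4 : ℕ) * ((n / 4 : ℕ) : ℝ) ^ 2)) := by
  obtain ⟨ρ, hρ⟩ := exists_injective_fin_div n 4
  obtain ⟨γ, hγ⟩ := exists_injective_fin_div m 4
  have : Fact (1 < 4) := ⟨by norm_num⟩
  have : Nonempty (Fin (n / 4)) := ⟨⟨0, by omega⟩⟩
  have : Nonempty (Fin (m / 4)) := ⟨⟨0, by omega⟩⟩
  have hcard : (Fintype.card (ZMod 4) : ℝ) = 4 := by simp [ZMod.card]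
  have hG : (0 : ℝ) < (n / 4 : ℕ) := by exact_mod_cast (by omega : 0 < n / 4)
  have hM : (0 : ℝ) < (m / 4 : ℕ) := by exact_mod_cast (by omega : 0 < m / 4)
  set G : ℝ := ((n / 4 : ℕ) : ℝ)
  have hk₀pos : 0 < k₀ := pos_of_mul_pos_right (by linarith : 0 < α * k₀) hα.le
  -- A heavy group receives about one of the `k₀` samples, and the heavy groups together carry
  -- about a hundredth of the mass that the prediction may misplace.
  set B : ℝ := G / k₀ with hB
  set η : ℝ := α * k₀ / (100 * G) with hη
  have hB4 : 4 ≤ B := (le_div_iff₀ hk₀pos).2 hk₀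
  have hη0 : 0 < η := by positivity
  have hηG : η * G = α * k₀ / 100 := by rw [hη]; field_simp
  have hηB : η * B = α / 100 := by rw [hη, hB]; field_simp
  have hη2 : η ≤ 1 / 2 := by nlinarith
  have hkB : k * B ≤ Fintype.card (Fin (n / 4)) := by
    rw [Fintype.card_fin, hB, mul_div_assoc', div_le_iff₀ hk₀pos, mul_comm]
    gcongr
  set e : ℝ := min 1 (5 * ε) with he
  have he0 : 0 ≤ e := le_min zero_le_one (by linarith)
  refine (le_of_stateMixture_chiSq_le hT hε hε3 (diagonalOverlapBound (ZMod 4)) (by norm_num)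
    (by linarith) he hρ hγ (β := α / 10) (by linarith) (by linarith)
    (by rw [hcard]; norm_num; linarith) (priorWeight_nonneg hη0.le (by linarith))
    (exists_priorWeight_pos η) (σ := id) (bad := {σ | 10 * (η * G) ≤ heavyCount σ})
    (sum_bad_priorWeight_mul_groupMass_pow_le hη0.le (by linarith) (by linarith) hkB ?_ ?_) ?_
    (sum_stateMixture_priorWeight_sq_div_le hη0 hη2 (by rw [hcard]; exact hB4) he0
      (min_le_left _ _))).trans (Real.exp_le_exp.2 ?_)
  · rw [Fintype.card_fin, hηG]
    linarith
  · simp [G]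
  · intro σ hσ
    have hσ' : heavyCount σ < 10 * (η * G) := by simpa using hσ
    rw [Fintype.card_fin, id, div_le_iff₀ hG]
    nlinarith
  · rw [Fintype.card_fin, Fintype.card_fin, hcard]
    exact masking_exponent_le hG hM hα (Nat.cast_nonneg k) hk hk₀pos he0 (min_le_right _ _)

end MaskingBound

section Regimes

variable {n m α ε b : ℝ}

theorem million_mul_lt_mul_pow (hn : 0 ≤ n) (hα : 0 ≤ α) (hα1 : α ≤ 1)
    (hreg : 1000000 * m < n * α ^ 2 * ε ^ 4) : 1000000 * m < n * ε ^ 4 := by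
  refine hreg.trans_le ?_
  gcongr
  exact mul_le_of_le_one_right hn (pow_le_one₀ hα hα1)

theorem le_card_of_masking_regime (hn : 0 ≤ n) (hm : 0 ≤ m) (hα : 0 ≤ α) (hα1 : α ≤ 1)
    (hε : 0 < ε) (hb : b ^ 3 * ε ^ 4 = n ^ 2 * m * α)
    (hreg : 1000000 * m < n * α ^ 2 * ε ^ 4) : b ≤ n := by
  have hmε := million_mul_lt_mul_pow hn hα hα1 hreg
  have hmα : m * α ≤ n * ε ^ 4 := by nlinarith
  refine le_of_pow_le_pow_left₀ three_ne_zero hn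
    (le_of_mul_le_mul_right ?_ (by positivity : 0 < ε ^ 4))
  calc b ^ 3 * ε ^ 4 = n ^ 2 * (m * α) := by rw [hb]; ring
    _ ≤ n ^ 2 * (n * ε ^ 4) := by gcongr
    _ = _ := by ring

theorem million_le_mul_of_masking_regime (hm : 2 ≤ m) (hα : 0 ≤ α) (hε : 0 < ε)
    (hε3 : ε ≤ 1 / 3) (hb0 : 0 ≤ b) (hb : b ^ 3 * ε ^ 4 = n ^ 2 * m * α)
    (hreg : 1000000 * m < n * α ^ 2 * ε ^ 4) : 1000000 ≤ α * b := by
  refine le_of_pow_le_pow_left₀ three_ne_zero (by positivity)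
    (le_of_mul_le_mul_right ?_ (by positivity : 0 < (ε ^ 4) ^ 3))
  calc (1000000 : ℝ) ^ 3 * (ε ^ 4) ^ 3 ≤ 1000000 ^ 3 * ((1 / 3) ^ 4) ^ 3 := by gcongr
    _ ≤ 1000000 ^ 2 * 2 ^ 2 * 2 := by norm_num
    _ ≤ 1000000 ^ 2 * m ^ 2 * m := by gcongr
    _ = (1000000 * m) ^ 2 * m := by ring
    _ ≤ (n * α ^ 2 * ε ^ 4) ^ 2 * m := by gcongr
    _ = α ^ 3 * (n ^ 2 * m * α) * (ε ^ 4) ^ 2 := by ring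
    _ = _ := by rw [← hb]; ring

theorem masking_exponent_le_quarter {G M : ℝ} (hn : 0 < n) (hm : 0 < m) (hα : 0 < α)
    (hb : b ^ 3 * ε ^ 4 = n ^ 2 * m * α) (hG : n / 5 ≤ G) (hM : m / 7 ≤ M) :
    8000000 * ε ^ 4 * (b / 10000) ^ 3 / (α * M * G ^ 2) ≤ 1 / 4 := by
  have hM0 : 0 < M := lt_of_lt_of_le (by positivity) hM
  have hG0 : 0 < G := lt_of_lt_of_le (by positivity) hG
  rw [div_le_iff₀ (by positivity)]
  calc 8000000 * ε ^ 4 * (b / 10000) ^ 3 = 8000000 / 10000 ^ 3 * (n ^ 2 * m * α) := by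
        rw [← hb]
        ring
    _ ≤ 1 / 4 * (α * (m / 7) * (n / 5) ^ 2) := by
        have : 0 < n ^ 2 * m * α := by positivity
        linarith
    _ ≤ _ := by gcongr

theorem div_le_of_masking_regime {n m k : ℕ} {T : Tester n m k}
    (hT : IsAugmentedIndependenceTester α ε 0.1 T) (hm : 4 ≤ m) (hα : 0 ≤ α) (hα1 : α ≤ 1)
    (hε : 0 < ε) (hε3 : ε < 1 / 3) (hb0 : 0 ≤ b) (hb : b ^ 3 * ε ^ 4 = n ^ 2 * m * α)
    (hreg : 1000000 * m < n * α ^ 2 * ε ^ 4) : b / 10000 ≤ k := by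
  by_contra! hk
  have hmR : (4 : ℝ) ≤ m := by exact_mod_cast hm
  have hbn := le_card_of_masking_regime (Nat.cast_nonneg n) (by linarith) hα hα1 hε hb hreg
  have hαb := million_le_mul_of_masking_regime (by linarith) hα hε hε3.le hb0 hb hreg
  have hαpos : 0 < α := hα.lt_of_ne fun h => by norm_num [← h] at hαb
  have hnR : 1000000 ≤ (n : ℝ) := hαb.trans ((mul_le_of_le_one_left hb0 hα1).trans hbn)
  have hn : 1000000 ≤ n := by exact_mod_cast hnR
  have hG : (n : ℝ) / 5 ≤ (n / 4 : ℕ) := by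
    have h : (n : ℝ) ≤ 5 * (n / 4 : ℕ) := by exact_mod_cast (by omega : n ≤ 5 * (n / 4))
    linarith
  have hM : (m : ℝ) / 7 ≤ (m / 4 : ℕ) := by
    have h : (m : ℝ) ≤ 7 * (m / 4 : ℕ) := by exact_mod_cast (by omega : m ≤ 7 * (m / 4))
    linarith
  have hquarter := quarter_lt_of_le_exp (le_exp_of_masking hT (by omega) hm hαpos hα1 hε hε3 hk.le
    (by linarith) (by linarith))
  exact hquarter.not_ge
    (masking_exponent_le_quarter (by linarith) (by linarith) hαpos hb hG hM)

theorem le_of_direct_regime {K : ℝ} (hn : 0 ≤ n) (hm : 0 ≤ m) (hε : 0 < ε) (hK : 0 ≤ K)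
    (hb : b ^ 3 * ε ^ 4 = n ^ 2 * m * α) (hreg : n * α ^ 2 * ε ^ 4 ≤ K ^ 6 * m) :
    b ≤ K * (√(n * m) / ε ^ 2) := by
  refine le_of_pow_le_pow_left₀ (by norm_num : 6 ≠ 0) (by positivity)
    (le_of_mul_le_mul_right ?_ (by positivity : 0 < ε ^ 12))
  calc b ^ 6 * ε ^ 12 = (b ^ 3 * ε ^ 4) ^ 2 * ε ^ 4 := by ring
    _ = n ^ 3 * m ^ 2 * (n * α ^ 2 * ε ^ 4) := by rw [hb]; ring
    _ ≤ n ^ 3 * m ^ 2 * (K ^ 6 * m) := by gcongr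
    _ = K ^ 6 * (√(n * m) ^ 2) ^ 3 := by rw [Real.sq_sqrt (by positivity)]; ring
    _ = _ := by field_simp

theorem rpow_bound_pow_three_mul (hn : 0 ≤ n) (hm : 0 ≤ m) (hα : 0 ≤ α) (hε : 0 < ε) :
    (n ^ (2 / 3 : ℝ) * m ^ (1 / 3 : ℝ) * α ^ (1 / 3 : ℝ) / ε ^ (4 / 3 : ℝ)) ^ 3 * ε ^ 4 =
      n ^ 2 * m * α := by
  have hcube (x : ℝ) (hx : 0 ≤ x) (p : ℕ) : (x ^ (p / 3 : ℝ)) ^ 3 = x ^ p := by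
    rw [← Real.rpow_natCast, ← Real.rpow_mul hx, ← Real.rpow_natCast x p]
    norm_num
  have hn2 := hcube n hn 2
  have hm1 := hcube m hm 1
  have hα1 := hcube α hα 1
  have hε4 := hcube ε hε.le 4
  push_cast at hn2 hm1 hα1 hε4
  rw [div_pow, mul_pow, mul_pow, hn2, hm1, hα1, hε4, pow_one, pow_one]
  field_simp

theorem four_le_or_le_of_log_le {n m : ℕ} (hlog : Real.log n ≤ m) : 4 ≤ m ∨ n ≤ 27 := by
  rcases le_or_gt 4 m with hm | hm
  · exact .inl hm
  refine .inr ?_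
  rcases n.eq_zero_or_pos with rfl | hn
  · norm_num
  have hm3 : (m : ℝ) ≤ 3 := by exact_mod_cast (by omega : m ≤ 3)
  have hnR : (0 : ℝ) < n := by exact_mod_cast hn
  have hn27 : (n : ℝ) ≤ 27 := by
    calc (n : ℝ) ≤ Real.exp 3 := (Real.log_le_iff_le_exp hnR).1 (hlog.trans hm3)
      _ = Real.exp 1 ^ 3 := by rw [← Real.exp_nat_mul]; norm_num
      _ ≤ 3 ^ 3 := by gcongr; exact Real.exp_one_lt_d9.le.trans (by norm_num)
      _ = 27 := by norm_num
  exact_mod_cast hn27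

theorem four_le_of_masking_regime {n m : ℕ} {K : ℝ} (hK : 1 ≤ K) (hnK : 4 ≤ m ∨ n ≤ K)
    (hm : 1 ≤ m) (hα : 0 ≤ α) (hα1 : α ≤ 1) (hε : 0 ≤ ε) (hε1 : ε ≤ 1)
    (hreg : K ^ 6 * m < n * α ^ 2 * ε ^ 4) : 4 ≤ m := by
  refine hnK.resolve_right fun hn => ?_
  have hmR : (1 : ℝ) ≤ m := by exact_mod_cast hm
  have hle : n * α ^ 2 * ε ^ 4 ≤ K ^ 6 * m := by
    calc (n : ℝ) * α ^ 2 * ε ^ 4 ≤ n * 1 ^ 2 * 1 ^ 4 := by gcongr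
      _ = (n : ℝ) := by ring
      _ ≤ K ^ 6 := hn.trans (le_self_pow₀ hK (by norm_num))
      _ ≤ _ := le_mul_of_one_le_right (by positivity) hmR
  exact hle.not_gt hreg

theorem le_mul_of_tester {n m k : ℕ} {K : ℝ} {T : Tester n m k}
    (hT : IsAugmentedIndependenceTester α ε 0.1 T) (hn : 2 ≤ n) (hm : 2 ≤ m) (hα : 0 ≤ α)
    (hα1 : α ≤ 1) (hε : 0 < ε) (hε3 : ε < 1 / 3) (hK : 10 ≤ K) (hnK : 4 ≤ m ∨ n ≤ K) (hb0 : 0 ≤ b)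
    (hb : b ^ 3 * ε ^ 4 = n ^ 2 * m * α) : b ≤ 1000 * K * k := by
  rcases lt_or_ge (K ^ 6 * m) (n * α ^ 2 * ε ^ 4) with hreg | hreg
  · have hm4 := four_le_of_masking_regime (by linarith) hnK (by omega) hα hα1 hε.le (by linarith)
      hreg
    have hreg' : 1000000 * m < n * α ^ 2 * ε ^ 4 := by
      refine lt_of_le_of_lt ?_ hreg
      gcongr
      exact le_trans (by norm_num) (pow_le_pow_left₀ (by norm_num) hK 6)
    have hmask := div_le_of_masking_regime hT hm4 hα hα1 hε hε3 hb0 hb hreg'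
    calc b ≤ 1000 * 10 * k := by linarith
      _ ≤ _ := by gcongr
  · calc b ≤ K * (√(n * m) / ε ^ 2) :=
          le_of_direct_regime (Nat.cast_nonneg n) (Nat.cast_nonneg m) hε (by linarith) hb hreg
      _ ≤ K * (110 * k) := by
          gcongr
          exact sqrt_mul_div_sq_le hT hn hm hα hε hε3
      _ = 110 * K * k := by ring
      _ ≤ _ := by gcongr; norm_num

end Regimes

end AugIndep

theorem theorem5_general (N : ℕ) :
    ∃ c : ℝ, 0 < c ∧
      ∀ (n m k : ℕ) (α ε : ℝ) (T : AugIndep.Tester n m k),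
        2 ≤ n → 2 ≤ m → 4 ≤ m ∨ n ≤ N →
        0 ≤ α → α ≤ 1 → 0 < ε → ε < 1 / 3 →
        AugIndep.IsAugmentedIndependenceTester α ε (0.1 : ℝ) T →
        c * max (Real.sqrt ((n : ℝ) * (m : ℝ)) / ε ^ 2)
            ((n : ℝ) ^ (2 / 3 : ℝ) * (m : ℝ) ^ (1 / 3 : ℝ) * α ^ (1 / 3 : ℝ) / ε ^ (4 / 3 : ℝ))
          ≤ (k : ℝ) := by
  set K : ℝ := max N 10
  have hK : 10 ≤ K := le_max_right _ _
  refine ⟨1 / (1000 * K), by positivity, ?_⟩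
  intro n m k α ε T hn hm hnN hα hα1 hε hε3 hT
  have hnK : 4 ≤ m ∨ n ≤ K := hnN.imp_right fun h => le_max_of_le_left (by exact_mod_cast h)
  have hdirect : √((n : ℝ) * m) / ε ^ 2 ≤ 1000 * K * k := by
    refine (AugIndep.sqrt_mul_div_sq_le hT hn hm hα hε hε3).trans ?_
    gcongr
    linarith
  have hmasking := AugIndep.le_mul_of_tester hT hn hm hα hα1 hε hε3 hK hnK (by positivity)
    (AugIndep.rpow_bound_pow_three_mul (Nat.cast_nonneg n) (Nat.cast_nonneg m) hα hε)
  rw [one_div_mul_eq_div, div_le_iff₀' (by positivity)]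
  exact max_le hdirect hmasking

theorem theorem5 :
    ∃ c : ℝ, 0 < c ∧
      ∀ (n m k : ℕ) (α ε : ℝ) (T : AugIndep.Tester n m k),
        2 ≤ m → m ≤ n → Real.log (n : ℝ) ≤ (m : ℝ) →
        0 ≤ α → α ≤ 1 → 0 < ε → ε < 1 / 3 →
        AugIndep.IsAugmentedIndependenceTester α ε (0.1 : ℝ) T →
        c * max (Real.sqrt ((n : ℝ) * (m : ℝ)) / ε ^ 2)
            ((n : ℝ) ^ (2 / 3 : ℝ) * (m : ℝ) ^ (1 / 3 : ℝ) * α ^ (1 / 3 : ℝ) / ε ^ (4 / 3 : ℝ))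
          ≤ (k : ℝ) := by
  obtain ⟨c, hc, h⟩ := theorem5_general 27
  exact ⟨c, hc, fun n m k α ε T hm hmn hlog =>
    h n m k α ε T (hm.trans hmn) hm (AugIndep.four_le_or_le_of_log_le hlog)⟩
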